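/- Let $N\ge 1$, let $\Omega=\{x=(x',x_N)\in\mathbb{R}^N : x_N>0\}$ be the upper half-space, and let $s\in(1/2,1)$, $\gamma>0$, $\nu_0>0$. For $\psi\in H^2(\Omega)$, with boundary values $\psi(x',0)$ understood in the sense of traces, define the extension $\widetilde\psi(x,v)$, $x,v\in\mathbb{R}^N$, by $\widetilde\psi(x,v)=\psi(x)$ if $x_N\ge 0$, and $\widetilde\psi(x,v)=\psi\big(x'-\tfrac{x_N}{v_N}v',0\big)$ if $x_N<0$ and $v_N<0$ (and $\widetilde\psi(x,v)=0$ at the remaining points, which play no role). Put $$D^{2s-1}[\psi](x)=\gamma\,\nu_0^{1-2s}\,\Gamma(2s)\int_{\mathbb{R}^N}\big[\widetilde\psi(y,y-x)-\psi(x)\big]\frac{y-x}{|y-x|^{N+2s}}\,dy ,$$ $$\mathcal{L}[\psi](x)=\gamma\,\nu_0^{1-2s}\,\Gamma(2s+1)\;\mathrm{P.V.}\!\int_{\mathbb{R}^N}\big[\widetilde\psi(y,y-x)-\psi(x)\big]\frac{1}{|y-x|^{N+2s}}\,dy ,$$ where $\mathrm{P.V.}$ means the limit as $\delta\to0^+$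 of the integrals over $\{|y-x|>\delta\}$. For every $\psi\in H^2(\Omega)$ and almost every $x\in\Omega$ the integral defining $D^{2s-1}[\psi](x)$ converges absolutely, the truncated integrals in $\mathcal L[\psi](x)$ converge absolutely for every $\delta>0$, and the principal value exists. If moreover $\mathcal L[\psi]\in L^2(\Omega)$, then $D^{2s-1}[\psi]\in L^1_{\mathrm{loc}}(\Omega)^N$ and $$\mathcal L[\psi]=\mathrm{div}\, D^{2s-1}[\psi]\quad\text{in }\Omega,$$ the divergence being taken in the sense of distributions: $\int_\Omega D^{2s-1}[\psi]\cdot\nabla\varphi\,dx=-\int_\Omega \mathcal L[\psi]\,\varphi\,dx$ for all $\varphi\in C_c^\infty(\Omega)$. -/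

import Mathlib

open MeasureTheory Filter Topology Set
open scoped Distributions

noncomputable section

namespace HalfSpace

/-- Euclidean space of dimension `N`. -/
abbrev E (N : ℕ) : Type := EuclideanSpace ℝ (Fin N)

/-- The last coordinate `x_N` of a point of the `N`-dimensional space, `N = n + 1`. -/
def height {n : ℕ} (x : E (n + 1)) : ℝ := x (Fin.last n)

/-- The first `N - 1` coordinates `x'` of `x = (x', x_N)`, `N = n + 1`. -/
def horiz {n : ℕ} (x : E (n + 1)) : E n := WithLp.toLp 2 (fun i : Fin n => x i.castSucc)

/-- The boundary point `(x', 0)`. -/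
def bdryPoint {n : ℕ} (x' : E n) : E (n + 1) :=
  WithLp.toLp 2 (Fin.snoc (α := fun _ => ℝ) (fun i : Fin n => x' i) 0)

/-- The open upper half space `{x | 0 < x_N}` in dimension `N = n + 1 ≥ 1`. -/
def Omega (n : ℕ) : TopologicalSpace.Opens (E (n + 1)) where
  carrier := {x | 0 < height x}
  is_open' := by
    apply isOpen_lt continuous_const
    unfold height
    fun_prop

/-- `g` is the weak partial derivative `∂_i u` on the open set `U`. -/
structure HasWeakPartial {N : ℕ} (U : TopologicalSpace.Opens (E N)) (i : Fin N)
    (u g : E N → ℝ) : Prop where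
  locInt_left : LocallyIntegrableOn u U volume
  locInt_right : LocallyIntegrableOn g U volume
  integral_eq : ∀ φ : 𝓓(U, ℝ),
    ∫ x in U, u x * fderiv ℝ φ x (EuclideanSpace.single i 1) = - ∫ x in U, g x * φ x

/-- `u ∈ H²(U)`: the function and its weak partial derivatives of orders one and two
are in `L²(U)`. -/
def MemH2 {N : ℕ} (U : TopologicalSpace.Opens (E N)) (u : E N → ℝ) : Prop :=
  MemLp u 2 (volume.restrict U) ∧
  ∃ (g : Fin N → E N → ℝ) (h : Fin N → Fin N → E N → ℝ),
    (∀ i, HasWeakPartial U i u (g i) ∧ MemLp (g i) 2 (volume.restrict U)) ∧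
    (∀ i j, HasWeakPartial U j (g i) (h i j) ∧ MemLp (h i j) 2 (volume.restrict U))

/-- `g` is the distributional divergence `div V` on the open set `U`:
`∫_U V · ∇φ = - ∫_U g φ` for all smooth `φ` with compact support in `U`. -/
structure HasWeakDiv {N : ℕ} (U : TopologicalSpace.Opens (E N))
    (V : E N → E N) (g : E N → ℝ) : Prop where
  locInt_left : LocallyIntegrableOn V U volume
  locInt_right : LocallyIntegrableOn g U volume
  integral_eq : ∀ φ : 𝓓(U, ℝ),
    ∫ x in U, fderiv ℝ φ x (V x) = - ∫ x in U, g x * φ x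

/-- `τ`, a function of `x'`, is the trace in `L²(∂Ω)` of `ψ` (for `ψ ∈ H¹(Ω)`): Green's formula
`∫_Ω (ψ ∂_N φ + φ ∂_N ψ) = - ∫ τ(x') φ(x', 0) dx'` holds for all smooth compactly
supported `φ` on the whole space (which need not vanish on `∂Ω`). -/
def IsTrace {n : ℕ} (ψ : E (n + 1) → ℝ) (τ : E n → ℝ) : Prop :=
  Measurable τ ∧ MemLp τ 2 volume ∧
  ∃ g : E (n + 1) → ℝ,
    HasWeakPartial (Omega n) (Fin.last n) ψ g ∧ MemLp g 2 (volume.restrict (Omega n)) ∧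
    ∀ φ : 𝓓((⊤ : TopologicalSpace.Opens (E (n + 1))), ℝ),
      ∫ x in Omega n, (ψ x * fderiv ℝ φ x (EuclideanSpace.single (Fin.last n) 1) + g x * φ x)
        = - ∫ x', τ x' * φ (bdryPoint x')

open Classical in
/-- The boundary values `x' ↦ ψ(x', 0)` of `ψ`, in the sense of traces
(and zero if `ψ` has no trace). -/
def trace {n : ℕ} (ψ : E (n + 1) → ℝ) : E n → ℝ :=
  if h : ∃ τ, IsTrace ψ τ then h.choose else 0

open Classical in
/-- The extension `ψ̃(x, v)` of `ψ`: it is `ψ(x)` on the closure of `Ω`, and outside it is constant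
along the lines of direction `v` that leave `Ω`. The remaining points, which play no role,
get the value zero. -/
def ext {n : ℕ} (ψ : E (n + 1) → ℝ) (x v : E (n + 1)) : ℝ :=
  if 0 < height x then ψ x
  else if height x = 0 then trace ψ (horiz x)
  else if height v < 0 then trace ψ (horiz x - (height x / height v) • horiz v)
  else 0

/-- The integrand `[ψ̃(y, y - x) - ψ(x)] (y - x) / |y - x|^{N + 2s}`. -/
def gradKernel {n : ℕ} (s : ℝ) (ψ : E (n + 1) → ℝ) (x y : E (n + 1)) : E (n + 1) :=
  ((ext ψ y (y - x) - ψ x) / ‖y - x‖ ^ (((n + 1 : ℕ) : ℝ) + 2 * s)) • (y - x)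

/-- The nonlocal gradient `D^{2s-1}[ψ]`. -/
def fracGrad {n : ℕ} (γ ν₀ s : ℝ) (ψ : E (n + 1) → ℝ) (x : E (n + 1)) : E (n + 1) :=
  (γ * ν₀ ^ (1 - 2 * s) * Real.Gamma (2 * s)) • ∫ y, gradKernel s ψ x y

/-- The integrand `[ψ̃(y, y - x) - ψ(x)] / |y - x|^{N + 2s}`. -/
def opKernel {n : ℕ} (s : ℝ) (ψ : E (n + 1) → ℝ) (x y : E (n + 1)) : ℝ :=
  (ext ψ y (y - x) - ψ x) / ‖y - x‖ ^ (((n + 1 : ℕ) : ℝ) + 2 * s)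

/-- The integral defining the operator `𝓛`, truncated to `|y - x| > δ`. -/
def truncOp {n : ℕ} (γ ν₀ s : ℝ) (ψ : E (n + 1) → ℝ) (δ : ℝ) (x : E (n + 1)) : ℝ :=
  γ * ν₀ ^ (1 - 2 * s) * Real.Gamma (2 * s + 1) *
    ∫ y in {y | δ < ‖y - x‖}, opKernel s ψ x y

/-- The operator `𝓛[ψ]`, a principal value: the limit of the truncations as `δ → 0+`. -/
def opL {n : ℕ} (γ ν₀ s : ℝ) (ψ : E (n + 1) → ℝ) (x : E (n + 1)) : ℝ :=
  limUnder (𝓝[>] (0 : ℝ)) (fun δ => truncOp γ ν₀ s ψ δ x)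

end HalfSpace

end

/-! Write `h = y - x`, `p = N + 2s`, `X(x,h) = ũ(x+h, h)`. The identity is Euler's relation for
homogeneous weights, in weak form. The extension depends on `v` only through its direction
(`extend_smul`), so for fixed `h` the function `x ↦ X(x,th)`, `t > 0`, is the translate by `th` of
one fixed locally integrable function. Tested against `φ`, its derivative in `t` falls on `φ`; no
regularity of the extension across `∂Ω` is needed.

Put `S(h) = ∫ (X(x,h) + X(x,-h) - 2u(x)) φ(x) dx` and `T(h) = ∫ (X(x,h) - X(x,-h)) h·∇φ(x) dx`. Then
`d/dt S(th) = -t⁻¹ T(th)` (`hasDerivAt_testedSecondDiff`), while scaling gives `∫ S(th)|h|^{-p} dh =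
t^{2s} ∫ S(h)|h|^{-p} dh`. Differentiating at `t = 1` yields `2s ∫ S|h|^{-p} = -∫ T|h|^{-p}`
(`integral_testedSecondDiff`). Fubini and the symmetry `h ↦ -h` turn the left integral into the
pairing of `𝓛[ψ]` with `φ` and the right one into that of `D^{2s-1}[ψ]` with `∇φ`, each with a
factor `1/2`; the constants match because `Γ(2s+1) = 2s Γ(2s)`.

All convergence comes from `exists_difference_le`: on a bounded set away from `∂Ω` the `L¹` norms in
`x` of the first and of the symmetric second differences of `X` are `O(min(|h|,1))` and `O(|h|
min(|h|,1))`. For small `h` this is the `H²` regularity of `u` inside `Ω`; for other `h` it is an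
`L²` bound on slabs, uniform in `h`. The resulting weight `|h| min(|h|,1)/|h|^p` is integrable
exactly because `1 < 2s < 2`. Of the trace only measurability and square integrability enter. -/

namespace HalfSpace

noncomputable section

open scoped ContDiff ENNReal

/-! ### The extension for arbitrary boundary data, and its slab bounds. -/

section Extension

variable {n : ℕ}

open Classical in
/-- The extension of `u` by the boundary values `τ`, for arbitrary boundary data `τ`. -/
def extend (u : E (n + 1) → ℝ) (τ : E n → ℝ) (x v : E (n + 1)) : ℝ :=
  if 0 < height x then u x
  else if height x = 0 then τ (horiz x)
  else if height v < 0 then τ (horiz x - (height x / height v) • horiz v)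
  else 0

theorem ext_eq_extend (ψ : E (n + 1) → ℝ) : ext ψ = extend ψ (trace ψ) := rfl

theorem measurable_trace (ψ : E (n + 1) → ℝ) : Measurable (trace ψ) := by
  unfold trace
  split_ifs with h
  · exact h.choose_spec.1
  · exact measurable_zero

theorem memLp_trace (ψ : E (n + 1) → ℝ) : MemLp (trace ψ) 2 volume := by
  unfold trace
  split_ifs with h
  · exact h.choose_spec.2.1
  · exact MemLp.zero

@[fun_prop]
theorem continuous_height : Continuous (height : E (n + 1) → ℝ) := by
  unfold height; fun_prop

@[fun_prop]
theorem continuous_horiz : Continuous (horiz : E (n + 1) → E n) := by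
  unfold horiz; fun_prop

@[simp]
theorem height_add (x y : E (n + 1)) : height (x + y) = height x + height y := rfl

@[simp]
theorem height_smul (c : ℝ) (x : E (n + 1)) : height (c • x) = c * height x := rfl

@[simp]
theorem horiz_smul (c : ℝ) (x : E (n + 1)) : horiz (c • x) = c • horiz x := by
  ext i; simp [horiz]

theorem abs_height_le (x : E (n + 1)) : |height x| ≤ ‖x‖ :=
  PiLp.norm_apply_le x (Fin.last n)

theorem measurePreserving_height_horiz :
    MeasurePreserving (fun x : E (n + 1) => (height x, horiz x)) volume
      ((volume : Measure ℝ).prod (volume : Measure (E n))) := by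
  have h1 := EuclideanSpace.volume_preserving_symm_measurableEquiv_toLp (Fin (n + 1))
  have h2 := volume_preserving_piFinSuccAbove (fun _ : Fin (n + 1) => ℝ) (Fin.last n)
  have h3 := (EuclideanSpace.volume_preserving_symm_measurableEquiv_toLp (Fin n)).symm
  have h4 := (MeasurePreserving.id (volume : Measure ℝ)).prod h3
  have h5 : (fun x : E (n + 1) => (height x, horiz x))
      = Prod.map id (MeasurableEquiv.toLp 2 (Fin n → ℝ)).symm.symm ∘
        MeasurableEquiv.piFinSuccAbove (fun _ => ℝ) (Fin.last n) ∘
        (MeasurableEquiv.toLp 2 (Fin (n + 1) → ℝ)).symm := by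
    funext x
    refine Prod.ext rfl (PiLp.ext fun i => ?_)
    exact congrArg x (Fin.succAbove_last_apply i).symm
  rw [h5]
  exact h4.comp (h2.comp h1)

theorem extend_of_pos (u : E (n + 1) → ℝ) (τ : E n → ℝ) {x : E (n + 1)} (v : E (n + 1))
    (hx : 0 < height x) : extend u τ x v = u x := if_pos hx

/-- The exit point depends only on the ratio of `v'` to `v_N`. This homogeneity of degree zero is
the one structural property of the extension behind the divergence identity. -/
theorem extend_smul (u : E (n + 1) → ℝ) (τ : E n → ℝ) (x v : E (n + 1)) {c : ℝ} (hc : 0 < c) :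
    extend u τ x (c • v) = extend u τ x v := by
  have h1 : height (c • v) < 0 ↔ height v < 0 := by
    rw [height_smul]; exact ⟨fun h => by nlinarith, fun h => mul_neg_of_pos_of_neg hc h⟩
  have h2 : (height x / height (c • v)) • horiz (c • v) = (height x / height v) • horiz v := by
    rw [height_smul, horiz_smul, smul_smul]
    congr 1
    field_simp
  simp only [extend, h1, h2]

theorem measurable_extend {u : E (n + 1) → ℝ} {τ : E n → ℝ} (hu : Measurable u)
    (hτ : Measurable τ) :
    Measurable (fun p : E (n + 1) × E (n + 1) => extend u τ p.1 p.2) := by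
  have m1 : Measurable (height : E (n + 1) → ℝ) := continuous_height.measurable
  have m2 : Measurable (horiz : E (n + 1) → E n) := continuous_horiz.measurable
  unfold extend
  refine Measurable.ite ?_ (by fun_prop) (Measurable.ite ?_ (by fun_prop)
    (Measurable.ite ?_ (by fun_prop) (by fun_prop)))
  · exact measurableSet_lt measurable_const (m1.comp measurable_fst)
  · exact measurableSet_eq_fun (m1.comp measurable_fst) measurable_const
  · exact measurableSet_lt (m1.comp measurable_snd) measurable_const

theorem enorm_extend_sq_le (u : E (n + 1) → ℝ) (τ : E n → ℝ) (x v : E (n + 1)) :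
    ‖extend u τ x v‖ₑ ^ 2 ≤ (Omega n : Set (E (n + 1))).indicator (fun y => ‖u y‖ₑ ^ 2) x
      + ‖τ (horiz x - (height x / height v) • horiz v)‖ₑ ^ 2 := by
  have hmem : x ∈ (Omega n : Set (E (n + 1))) ↔ 0 < height x := Iff.rfl
  unfold extend
  split_ifs with h1 h2 h3
  · rw [indicator_of_mem (hmem.2 h1)]; exact le_self_add
  -- At height zero the shift vanishes, whatever `v` is, so the second term is exactly the boundary
  -- value.
  · simp [h2]
  · exact le_add_self
  · simp

/-- An `L²` bound of the extension on slabs, uniform in the direction. -/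
theorem lintegral_slab_extend_le {u : E (n + 1) → ℝ} {τ : E n → ℝ} (hu : Measurable u)
    (hτ : Measurable τ) (a b : ℝ) (v : E (n + 1)) :
    ∫⁻ y in {y | height y ∈ Ioo a b}, ‖extend u τ y v‖ₑ ^ 2
      ≤ (∫⁻ y in Omega n, ‖u y‖ₑ ^ 2) + ENNReal.ofReal (b - a) * ∫⁻ z, ‖τ z‖ₑ ^ 2 := by
  have hΩ : MeasurableSet (Omega n : Set (E (n + 1))) := (Omega n).isOpen.measurableSet
  calc ∫⁻ y in {y | height y ∈ Ioo a b}, ‖extend u τ y v‖ₑ ^ 2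
      ≤ ∫⁻ y in {y | height y ∈ Ioo a b},
          ((Omega n : Set (E (n + 1))).indicator (fun y => ‖u y‖ₑ ^ 2) y
            + ‖τ (horiz y - (height y / height v) • horiz v)‖ₑ ^ 2) :=
        lintegral_mono fun y => enorm_extend_sq_le u τ y v
    _ = (∫⁻ y in {y | height y ∈ Ioo a b},
          (Omega n : Set (E (n + 1))).indicator (fun y => ‖u y‖ₑ ^ 2) y)
        + ∫⁻ y in {y | height y ∈ Ioo a b},
            ‖τ (horiz y - (height y / height v) • horiz v)‖ₑ ^ 2 :=
        lintegral_add_left ((hu.enorm.pow_const 2).indicator hΩ) _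
    _ ≤ (∫⁻ y in Omega n, ‖u y‖ₑ ^ 2) + ENNReal.ofReal (b - a) * ∫⁻ z, ‖τ z‖ₑ ^ 2 := by
        refine add_le_add ?_ ?_
        · rw [← lintegral_indicator hΩ]
          exact setLIntegral_le_lintegral _ _
        · have hmeas : Measurable fun q : ℝ × E n =>
              ‖τ (q.2 - (q.1 / height v) • horiz v)‖ₑ ^ 2 := by fun_prop
          have hpre : {y : E (n + 1) | height y ∈ Ioo a b}
              = (fun x : E (n + 1) => (height x, horiz x)) ⁻¹' (Ioo a b ×ˢ univ) := by
            ext y; simp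
          rw [hpre, measurePreserving_height_horiz.setLIntegral_comp_preimage
            (measurableSet_Ioo.prod MeasurableSet.univ) hmeas,
            ← Measure.prod_restrict, lintegral_prod _ hmeas.aemeasurable]
          simp only [Measure.restrict_univ]
          -- At each fixed height the boundary term is a horizontal translate of `τ`, so the
          -- direction `v` drops out of its norm.
          have hsub : ∀ t : ℝ, ∫⁻ z : E n, ‖τ (z - (t / height v) • horiz v)‖ₑ ^ 2
              = ∫⁻ z, ‖τ z‖ₑ ^ 2 := fun t =>
            lintegral_sub_right_eq_self (fun z => ‖τ z‖ₑ ^ 2) _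
          simp only [hsub, lintegral_const, Measure.restrict_apply_univ, Real.volume_Ioo]
          rw [mul_comm]

/-- Open bounded subsets exhausting the half space. -/
def box (n : ℕ) (R ε : ℝ) : Set (E (n + 1)) := {x | ‖x‖ < R ∧ ε < height x}

theorem isOpen_box (R ε : ℝ) : IsOpen (box n R ε) :=
  (isOpen_lt continuous_norm continuous_const).inter
    (isOpen_lt continuous_const continuous_height)

theorem box_subset_Omega {R ε : ℝ} (hε : 0 ≤ ε) : box n R ε ⊆ Omega n :=
  fun _ hx => hε.trans_lt hx.2

theorem volume_box_lt_top (R ε : ℝ) : volume (box n R ε) < ⊤ :=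
  (measure_mono fun _ hx => mem_ball_zero_iff.2 hx.1).trans_lt
    (measure_ball_lt_top (x := (0 : E (n + 1))) (r := R))

theorem add_mem_box {R ε r : ℝ} {x h : E (n + 1)} (hx : x ∈ box n R ε) (hh : ‖h‖ ≤ r) :
    x + h ∈ box n (R + r) (ε - r) := by
  have h1 := abs_le.1 ((abs_height_le h).trans hh)
  exact ⟨(norm_add_le _ _).trans_lt (by linarith [hx.1]), by rw [height_add]; linarith [hx.2]⟩

theorem box_mono {R R' ε ε' : ℝ} (hR : R ≤ R') (hε : ε' ≤ ε) : box n R ε ⊆ box n R' ε' :=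
  fun _ hx => ⟨hx.1.trans_le hR, hε.trans_lt hx.2⟩

theorem integrableOn_box {u : E (n + 1) → ℝ} (hu : LocallyIntegrableOn u (Omega n) volume)
    (R : ℝ) {ε : ℝ} (hε : 0 < ε) : IntegrableOn u (box n R ε) volume := by
  have hK : IsCompact (Metric.closedBall (0 : E (n + 1)) R ∩ {x | ε ≤ height x}) :=
    (isCompact_closedBall _ _).inter_right (isClosed_le continuous_const continuous_height)
  refine (hu.integrableOn_compact_subset (fun x hx => ?_) hK).mono_set fun x hx => ?_
  · exact hε.trans_le hx.2
  · exact ⟨mem_closedBall_zero_iff.2 hx.1.le, hx.2.le⟩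

/-- Compact subsets of the half space lie in one of the boxes. -/
theorem exists_subset_box {K : Set (E (n + 1))} (hK : IsCompact K)
    (hKΩ : K ⊆ Omega n) : ∃ R ε : ℝ, 0 < R ∧ 0 < ε ∧ K ⊆ box n R ε := by
  obtain ⟨R, hR, hKR⟩ := hK.isBounded.subset_ball_lt 0 0
  rcases K.eq_empty_or_nonempty with rfl | hne
  · exact ⟨1, 1, one_pos, one_pos, empty_subset _⟩
  obtain ⟨z, hz, hmin⟩ := hK.exists_isMinOn hne continuous_height.continuousOn
  have hz0 : 0 < height z := hKΩ hz
  refine ⟨R, height z / 2, hR, by positivity, fun x hx => ⟨mem_ball_zero_iff.1 (hKR hx), ?_⟩⟩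
  have : height z ≤ height x := hmin hx
  linarith

end Extension

/-! ### Differences as integrals of weak derivatives along segments. -/

section Translation

variable {N : ℕ}

/-- `w` is the weak derivative of `u` in direction `h` on the set `W`; the integrals are over
the whole space. -/
def WeakDirDeriv (W : Set (E N)) (h : E N) (u w : E N → ℝ) : Prop :=
  ∀ φ : E N → ℝ, ContDiff ℝ ∞ φ → HasCompactSupport φ → tsupport φ ⊆ W →
    ∫ x, u x * fderiv ℝ φ x h = - ∫ x, w x * φ x

/-- Each slice in `t` is a translation. This justifies Fubini for `w (x + t • h)`. -/
theorem measurePreserving_shear (h : E N) :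
    MeasurePreserving (fun q : E N × ℝ => (q.1 + q.2 • h, q.2))
      ((volume : Measure (E N)).prod (volume.restrict (Icc (0 : ℝ) 1)))
      ((volume : Measure (E N)).prod (volume.restrict (Icc (0 : ℝ) 1))) := by
  have h1 : MeasurePreserving (fun q : ℝ × E N => (q.1, q.2 + q.1 • h))
      ((volume.restrict (Icc (0 : ℝ) 1)).prod (volume : Measure (E N)))
      ((volume.restrict (Icc (0 : ℝ) 1)).prod (volume : Measure (E N))) :=
    (MeasurePreserving.id _).skew_product (g := fun t x => x + t • h) (by fun_prop)
      (Eventually.of_forall fun t => (measurePreserving_add_right volume (t • h)).map_eq)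
  exact Measure.measurePreserving_swap.comp (h1.comp Measure.measurePreserving_swap)

theorem integrable_shear {w : E N → ℝ} (hw : Integrable w) (h : E N) :
    Integrable (fun q : E N × ℝ => w (q.1 + q.2 • h))
      ((volume : Measure (E N)).prod (volume.restrict (Icc (0 : ℝ) 1))) :=
  (measurePreserving_shear h).integrable_comp_of_integrable
    (g := fun q : E N × ℝ => w q.1) (hw.comp_fst _)

theorem tsupport_comp_sub_right (φ : E N → ℝ) (c : E N) :
    tsupport (fun y => φ (y - c)) = (fun y => y - c) ⁻¹' tsupport φ :=
  tsupport_comp_eq_preimage φ (Homeomorph.subRight c)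

theorem fderiv_comp_sub_right (φ : E N → ℝ) (c y : E N) :
    fderiv ℝ (fun y => φ (y - c)) y = fderiv ℝ φ (y - c) := by
  simp only [sub_eq_add_neg, fderiv_comp_add_right]

theorem integral_fderiv_segment {φ : E N → ℝ} (hφ : ContDiff ℝ ∞ φ) (y h : E N) :
    ∫ t in Icc (0 : ℝ) 1, fderiv ℝ φ (y - t • h) h = φ y - φ (y - h) := by
  have hd : ∀ t : ℝ, HasDerivAt (fun t : ℝ => -φ (y - t • h)) (fderiv ℝ φ (y - t • h) h) t := by
    intro t
    have h1 : HasDerivAt (fun t : ℝ => y - t • h) (-h) t := by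
      simpa using ((hasDerivAt_id t).smul_const h).const_sub y
    have h2 := (((hφ.differentiable (by simp)) (y - t • h)).hasFDerivAt.comp_hasDerivAt t h1).neg
    rw [map_neg, neg_neg] at h2
    exact h2
  have hc : Continuous fun t : ℝ => fderiv ℝ φ (y - t • h) h :=
    ((hφ.continuous_fderiv (by simp)).comp (by fun_prop)).clm_apply continuous_const
  rw [integral_Icc_eq_integral_Ioc, ← intervalIntegral.integral_of_le zero_le_one,
    intervalIntegral.integral_eq_sub_of_hasDerivAt (fun t _ => hd t)
      (hc.intervalIntegrable _ _)]
  simp; ring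

theorem exists_norm_fderiv_le {φ : E N → ℝ} (hφ : ContDiff ℝ ∞ φ) (hc : HasCompactSupport φ) :
    ∃ C, ∀ y, ‖fderiv ℝ φ y‖ ≤ C :=
  (hφ.continuous_fderiv (by simp)).bounded_above_of_compact_support (hc.fderiv ℝ)

/-- The increment of a function is the integral of its weak derivative along a segment. -/
theorem WeakDirDeriv.ae_sub_eq_integral {V W : Set (E N)} (hV : IsOpen V) {h : E N}
    {u w : E N → ℝ} (H : WeakDirDeriv W h u w) (hu : Integrable u) (hw : Integrable w)
    (hVW : ∀ x ∈ V, ∀ t ∈ Icc (0 : ℝ) 1, x + t • h ∈ W) :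
    ∀ᵐ x ∂(volume.restrict V), u (x + h) - u x = ∫ t in Icc (0 : ℝ) 1, w (x + t • h) := by
  have hws := integrable_shear hw h
  have huh : Integrable fun x => u (x + h) := hu.comp_add_right h
  have hfi : Integrable fun x => u (x + h) - u x - ∫ t in Icc (0 : ℝ) 1, w (x + t • h) :=
    (huh.sub hu).sub hws.integral_prod_left
  rw [ae_restrict_iff' hV.measurableSet]
  -- Fundamental lemma of the calculus of variations: it suffices to test the identity against `φ`
  -- supported in `V`.
  have key := hV.ae_eq_zero_of_integral_contDiff_smul_eq_zero
    (hfi.locallyIntegrable.locallyIntegrableOn V) (fun φ hφ hφc hφV => ?_)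
  · filter_upwards [key] with x hx hxV
    exact sub_eq_zero.1 (hx hxV)
  obtain ⟨C, hC⟩ := hφ.continuous.bounded_above_of_compact_support hφc
  obtain ⟨C', hC'⟩ := exists_norm_fderiv_le hφ hφc
  have i1 : Integrable fun x => φ x * u (x + h) :=
    huh.bdd_mul (hφ.continuous.aestronglyMeasurable) (Eventually.of_forall hC)
  have i2 : Integrable fun x => φ x * u x :=
    hu.bdd_mul (hφ.continuous.aestronglyMeasurable) (Eventually.of_forall hC)
  have i3 : Integrable (fun q : E N × ℝ => φ q.1 * w (q.1 + q.2 • h))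
      ((volume : Measure (E N)).prod (volume.restrict (Icc (0 : ℝ) 1))) :=
    hws.bdd_mul (hφ.continuous.comp continuous_fst).aestronglyMeasurable
      (Eventually.of_forall fun q => hC q.1)
  have i4 : Integrable (fun q : E N × ℝ => u q.1 * fderiv ℝ φ (q.1 - q.2 • h) h)
      ((volume : Measure (E N)).prod (volume.restrict (Icc (0 : ℝ) 1))) := by
    refine (hu.comp_fst _).mul_bdd (c := C' * ‖h‖) ?_ (Eventually.of_forall fun q => ?_)
    · exact (((hφ.continuous_fderiv (by simp)).comp (by fun_prop)).clm_apply
        continuous_const).aestronglyMeasurable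
    · exact (ContinuousLinearMap.le_opNorm _ _).trans
        (mul_le_mul_of_nonneg_right (hC' _) (norm_nonneg _))
  -- For each `t` the translation moves to `φ`, whose shifted support stays in `W`; the weak
  -- derivative then moves to `φ`, where the integral in `t` is computed classically.
  have e3 : ∫ x, φ x * ∫ t in Icc (0 : ℝ) 1, w (x + t • h)
      = ∫ x, (φ (x - h) - φ x) * u x := by
    calc ∫ x, φ x * ∫ t in Icc (0 : ℝ) 1, w (x + t • h)
        = ∫ x, ∫ t in Icc (0 : ℝ) 1, φ x * w (x + t • h) := by
          simp only [integral_const_mul]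
      _ = ∫ t in Icc (0 : ℝ) 1, ∫ x, φ x * w (x + t • h) := integral_integral_swap i3
      _ = ∫ t in Icc (0 : ℝ) 1, - ∫ x, u x * fderiv ℝ φ (x - t • h) h := by
          refine setIntegral_congr_fun measurableSet_Icc fun t ht => ?_
          have h1 := H (fun y => φ (y - t • h)) (hφ.comp (contDiff_id.sub contDiff_const))
            (hφc.comp_homeomorph (Homeomorph.subRight (t • h))) (by
              rw [tsupport_comp_sub_right]
              intro y hy
              simpa using hVW _ (hφV hy) t ht)
          simp only [fderiv_comp_sub_right] at h1
          have h2 : ∫ x, φ x * w (x + t • h) = ∫ x, w x * φ (x - t • h) := by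
            rw [← integral_add_right_eq_self (fun x => w x * φ (x - t • h)) (t • h)]
            refine integral_congr_ae (Eventually.of_forall fun x => ?_)
            simp only [add_sub_cancel_right, mul_comm]
          simp only [h1, h2, neg_neg]
      _ = - ∫ t in Icc (0 : ℝ) 1, ∫ x, u x * fderiv ℝ φ (x - t • h) h := integral_neg _
      _ = - ∫ x, ∫ t in Icc (0 : ℝ) 1, u x * fderiv ℝ φ (x - t • h) h := by
          rw [← integral_integral_swap i4]
      _ = ∫ x, (φ (x - h) - φ x) * u x := by
          rw [← integral_neg]
          refine integral_congr_ae (Eventually.of_forall fun x => ?_)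
          simp only [integral_const_mul, integral_fderiv_segment hφ]
          ring
  have e1 : ∫ x, φ x * u (x + h) = ∫ x, φ (x - h) * u x := by
    rw [← integral_add_right_eq_self (fun x => φ (x - h) * u x) h]
    simp only [add_sub_cancel_right]
  have i5 : Integrable fun x => φ (x - h) * u x :=
    hu.bdd_mul ((hφ.continuous.comp (by fun_prop)).aestronglyMeasurable)
      (Eventually.of_forall fun x => hC _)
  have i6 : Integrable fun x => φ x * ∫ t in Icc (0 : ℝ) 1, w (x + t • h) :=
    hws.integral_prod_left.bdd_mul (hφ.continuous.aestronglyMeasurable) (Eventually.of_forall hC)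
  simp only [smul_eq_mul, mul_sub]
  have i12 : Integrable fun x => φ x * u (x + h) - φ x * u x := i1.sub i2
  rw [integral_sub i12 i6, integral_sub i1 i2, e3, e1]
  simp only [sub_mul]
  rw [integral_sub i5 i2]
  ring

theorem lintegral_sub_le_of_ae_eq {V : Set (E N)} {h : E N} {u w : E N → ℝ}
    (hw : Integrable w) (H : ∀ᵐ x ∂(volume.restrict V),
      u (x + h) - u x = ∫ t in Icc (0 : ℝ) 1, w (x + t • h)) :
    ∫⁻ x in V, ‖u (x + h) - u x‖ₑ ≤ ∫⁻ x, ‖w x‖ₑ := by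
  calc ∫⁻ x in V, ‖u (x + h) - u x‖ₑ
      = ∫⁻ x in V, ‖∫ t in Icc (0 : ℝ) 1, w (x + t • h)‖ₑ :=
        lintegral_congr_ae (H.mono fun x hx => by simp only [hx])
    _ ≤ ∫⁻ x, ‖∫ t in Icc (0 : ℝ) 1, w (x + t • h)‖ₑ := setLIntegral_le_lintegral _ _
    _ ≤ ∫⁻ x, ∫⁻ t in Icc (0 : ℝ) 1, ‖w (x + t • h)‖ₑ :=
        lintegral_mono fun x => enorm_integral_le_lintegral_enorm _
    _ = ∫⁻ t in Icc (0 : ℝ) 1, ∫⁻ x, ‖w (x + t • h)‖ₑ :=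
        lintegral_lintegral_swap (integrable_shear hw h).aestronglyMeasurable.enorm
    _ = ∫⁻ x, ‖w x‖ₑ := by
        have : ∀ t : ℝ, ∫⁻ x, ‖w (x + t • h)‖ₑ = ∫⁻ x, ‖w x‖ₑ := fun t =>
          lintegral_add_right_eq_self (fun x => ‖w x‖ₑ) _
        simp [this]

theorem WeakDirDeriv.lintegral_sub_le {V W : Set (E N)} (hV : IsOpen V) {h : E N}
    {u w : E N → ℝ} (H : WeakDirDeriv W h u w) (hu : Integrable u) (hw : Integrable w)
    (hVW : ∀ x ∈ V, ∀ t ∈ Icc (0 : ℝ) 1, x + t • h ∈ W) :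
    ∫⁻ x in V, ‖u (x + h) - u x‖ₑ ≤ ∫⁻ x, ‖w x‖ₑ :=
  lintegral_sub_le_of_ae_eq hw (H.ae_sub_eq_integral hV hu hw hVW)

/-- Symmetric second differences are controlled by the second weak derivative. -/
theorem WeakDirDeriv.lintegral_second_difference_le {V V' W : Set (E N)}
    (hV : IsOpen V) (hV' : IsOpen V') {h : E N} {u w w' : E N → ℝ}
    (H : WeakDirDeriv W h u w) (H' : WeakDirDeriv W h w w')
    (hu : Integrable u) (hw : Integrable w) (hw' : Integrable w')
    (hVV' : ∀ x ∈ V, ∀ t ∈ Icc (-1 : ℝ) 0, x + t • h ∈ V')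
    (hVW : ∀ x ∈ V', ∀ t ∈ Icc (0 : ℝ) 1, x + t • h ∈ W) :
    ∫⁻ x in V, ‖u (x + h) + u (x - h) - 2 * u x‖ₑ ≤ ∫⁻ x, ‖w' x‖ₑ := by
  have hVsub : V ⊆ V' := fun x hx => by simpa using hVV' x hx 0 (by simp)
  have A := H.ae_sub_eq_integral hV' hu hw hVW
  have A1 := ae_restrict_of_ae_restrict_of_subset hVsub A
  have A2 : ∀ᵐ x ∂(volume.restrict V),
      u x - u (x - h) = ∫ t in Icc (0 : ℝ) 1, w (x - h + t • h) := by
    rw [ae_restrict_iff' hV'.measurableSet] at A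
    rw [ae_restrict_iff' hV.measurableSet]
    have := (measurePreserving_sub_right volume h).quasiMeasurePreserving.ae A
    filter_upwards [this] with x hx hxV
    have h1 := hx (by simpa [sub_eq_add_neg] using hVV' x hxV (-1) (by simp))
    simpa using h1
  have s1 := integrable_shear hw h
  have s2 : Integrable (fun q : E N × ℝ => w (q.1 - h + q.2 • h))
      ((volume : Measure (E N)).prod (volume.restrict (Icc (0 : ℝ) 1))) := by
    have := integrable_shear (hw.comp_sub_right h) h
    refine this.congr (Eventually.of_forall fun q => ?_)
    simp only
    congr 1
    abel
  -- The second difference is the integral over `t` of the first difference of `w` based at `x + (t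
  -- - 1) • h`, to which the first-order bound applies again.
  have B : ∀ᵐ x ∂(volume.restrict V), u (x + h) + u (x - h) - 2 * u x
      = ∫ t in Icc (0 : ℝ) 1, (w (x + t • h) - w (x - h + t • h)) := by
    filter_upwards [A1, A2, ae_restrict_of_ae s1.prod_right_ae,
      ae_restrict_of_ae s2.prod_right_ae] with x h1 h2 h3 h4
    rw [integral_sub h3 h4, ← h1, ← h2]
    ring
  have sm := (s1.sub s2).aestronglyMeasurable.enorm
  calc ∫⁻ x in V, ‖u (x + h) + u (x - h) - 2 * u x‖ₑ
      = ∫⁻ x in V, ‖∫ t in Icc (0 : ℝ) 1, (w (x + t • h) - w (x - h + t • h))‖ₑ :=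
        lintegral_congr_ae (B.mono fun x hx => by simp only [hx])
    _ ≤ ∫⁻ x in V, ∫⁻ t in Icc (0 : ℝ) 1, ‖w (x + t • h) - w (x - h + t • h)‖ₑ :=
        lintegral_mono fun x => enorm_integral_le_lintegral_enorm _
    _ = ∫⁻ t in Icc (0 : ℝ) 1, ∫⁻ x in V, ‖w (x + t • h) - w (x - h + t • h)‖ₑ := by
        refine lintegral_lintegral_swap (sm.mono_measure ?_)
        exact Measure.prod_mono Measure.restrict_le_self le_rfl
    _ ≤ ∫⁻ _ in Icc (0 : ℝ) 1, ∫⁻ x, ‖w' x‖ₑ := by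
        refine setLIntegral_mono' measurableSet_Icc fun t ht => ?_
        refine le_trans ?_ (H'.lintegral_sub_le hV' hw hw' hVW)
        have hpre : V ⊆ (fun x => x + (t - 1) • h) ⁻¹' V' := fun x hx =>
          hVV' x hx (t - 1) ⟨by linarith [ht.1], by linarith [ht.2]⟩
        have hmp := (measurePreserving_add_right (volume : Measure (E N)) ((t - 1) • h))
        calc ∫⁻ x in V, ‖w (x + t • h) - w (x - h + t • h)‖ₑ
            ≤ ∫⁻ x in (fun x => x + (t - 1) • h) ⁻¹' V',
                ‖w (x + t • h) - w (x - h + t • h)‖ₑ := lintegral_mono_set hpre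
          _ = ∫⁻ x in (fun x => x + (t - 1) • h) ⁻¹' V',
                ‖w (x + (t - 1) • h + h) - w (x + (t - 1) • h)‖ₑ := by
              refine lintegral_congr fun x => ?_
              congr 3 <;> module
          _ = ∫⁻ x in V', ‖w (x + h) - w x‖ₑ :=
              hmp.setLIntegral_comp_preimage_emb
                (Homeomorph.addRight ((t - 1) • h)).measurableEmbedding
                (fun x => ‖w (x + h) - w x‖ₑ) V'
    _ = ∫⁻ x, ‖w' x‖ₑ := by simp

end Translation

/-! ### Interior difference estimates for `H²` functions. -/

section SobolevDifferences

theorem WeakDirDeriv.sum {N : ℕ} {W : Set (E N)} {h : E N} {u w : Fin N → E N → ℝ}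
    (H : ∀ i, WeakDirDeriv W h (u i) (w i)) (hu : ∀ i, Integrable (u i))
    (hw : ∀ i, Integrable (w i)) (c : Fin N → ℝ) :
    WeakDirDeriv W h (fun x => ∑ i, c i * u i x) (fun x => ∑ i, c i * w i x) := by
  intro φ hφ hφc hφW
  obtain ⟨C, hC⟩ := hφ.continuous.bounded_above_of_compact_support hφc
  obtain ⟨C', hC'⟩ := exists_norm_fderiv_le hφ hφc
  have i1 : ∀ i, Integrable fun x => u i x * fderiv ℝ φ x h := fun i =>
    (hu i).mul_bdd (c := C' * ‖h‖)
      ((hφ.continuous_fderiv (by simp)).clm_apply continuous_const).aestronglyMeasurable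
      (Eventually.of_forall fun x => (ContinuousLinearMap.le_opNorm _ _).trans
        (mul_le_mul_of_nonneg_right (hC' _) (norm_nonneg _)))
  have i2 : ∀ i, Integrable fun x => w i x * φ x := fun i =>
    (hw i).mul_bdd hφ.continuous.aestronglyMeasurable (Eventually.of_forall hC)
  simp only [Finset.sum_mul, mul_assoc]
  rw [integral_finsetSum _ fun i _ => (i1 i).const_mul (c i),
    integral_finsetSum _ fun i _ => (i2 i).const_mul (c i), ← Finset.sum_neg_distrib]
  refine Finset.sum_congr rfl fun i _ => ?_
  rw [integral_const_mul, integral_const_mul, H i φ hφ hφc hφW, mul_neg]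

/-- Test functions supported in `W` do not see the cutoff to `W`, so `u` and its partial derivatives
may be replaced by globally integrable functions; a direction `h` is then expanded in coordinates.
-/
theorem HasWeakPartial.weakDirDeriv {N : ℕ} {U : TopologicalSpace.Opens (E N)} {W : Set (E N)}
    (hW : MeasurableSet W) (hWU : W ⊆ U) {u : E N → ℝ} {g : Fin N → E N → ℝ}
    (hg : ∀ i, HasWeakPartial U i u (g i)) (hu : IntegrableOn u W)
    (hgW : ∀ i, IntegrableOn (g i) W) (h : E N) :
    WeakDirDeriv W h (W.indicator u) (fun x => ∑ i, h i * W.indicator (g i) x) := by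
  intro φ hφ hφc hφW
  have hsup : ∀ (f : E N → ℝ) (F : E N → ℝ), (∀ x, x ∉ tsupport φ → F x = 0) →
      ∫ x, W.indicator f x * F x = ∫ x in U, f x * F x := by
    intro f F hF
    have h1 : ∀ x, W.indicator f x * F x = (U : Set (E N)).indicator (fun x => f x * F x) x := by
      intro x
      by_cases hx : x ∈ tsupport φ
      · rw [indicator_of_mem (hφW hx), indicator_of_mem (hWU (hφW hx))]
      · simp [indicator, hF x hx]
    simp only [h1]
    exact integral_indicator U.isOpen.measurableSet
  have z1 : ∀ x, x ∉ tsupport φ → φ x = 0 := fun x hx => image_eq_zero_of_notMem_tsupport hx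
  have z2 : ∀ (v : E N) x, x ∉ tsupport φ → fderiv ℝ φ x v = 0 := fun v x hx => by
    rw [fderiv_of_notMem_tsupport ℝ hx]; rfl
  obtain ⟨C, hC⟩ := hφ.continuous.bounded_above_of_compact_support hφc
  obtain ⟨C', hC'⟩ := exists_norm_fderiv_le hφ hφc
  have iu : Integrable (W.indicator u) := hu.integrable_indicator hW
  have ig : ∀ i, Integrable (W.indicator (g i)) := fun i => (hgW i).integrable_indicator hW
  have i1 : ∀ v : E N, Integrable fun x => W.indicator u x * fderiv ℝ φ x v := fun v =>
    iu.mul_bdd (c := C' * ‖v‖)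
      ((hφ.continuous_fderiv (by simp)).clm_apply continuous_const).aestronglyMeasurable
      (Eventually.of_forall fun x => (ContinuousLinearMap.le_opNorm _ _).trans
        (mul_le_mul_of_nonneg_right (hC' _) (norm_nonneg _)))
  have i2 : ∀ i, Integrable fun x => W.indicator (g i) x * φ x := fun i =>
    (ig i).mul_bdd hφ.continuous.aestronglyMeasurable (Eventually.of_forall hC)
  have hh : h = ∑ i, h i • EuclideanSpace.single i (1 : ℝ) := by
    ext j
    simp [Pi.single_apply]
  have e1 : ∀ x, W.indicator u x * fderiv ℝ φ x h
      = ∑ i, h i * (W.indicator u x * fderiv ℝ φ x (EuclideanSpace.single i 1)) := by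
    intro x
    conv_lhs => rw [hh, map_sum, Finset.mul_sum]
    refine Finset.sum_congr rfl fun i _ => ?_
    rw [map_smul, smul_eq_mul]
    ring
  simp only [e1, Finset.sum_mul, mul_assoc]
  rw [integral_finsetSum _ fun i _ => (i1 _).const_mul (h i),
    integral_finsetSum _ fun i _ => (i2 i).const_mul (h i), ← Finset.sum_neg_distrib]
  refine Finset.sum_congr rfl fun i _ => ?_
  have := (hg i).integral_eq ⟨φ, hφ, hφc, hφW.trans hWU⟩
  rw [integral_const_mul, integral_const_mul, hsup _ _ (z2 _), hsup _ _ z1]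
  rw [← mul_neg]
  exact congrArg _ this

theorem enorm_apply_le {N : ℕ} (h : E N) (i : Fin N) : ‖h i‖ₑ ≤ ‖h‖ₑ :=
  enorm_le_iff_norm_le.2 (PiLp.norm_apply_le h i)

theorem lintegral_enorm_sum_mul_le {N : ℕ} (h : E N) {g : Fin N → E N → ℝ}
    (hg : ∀ i, Integrable (g i)) :
    ∫⁻ x, ‖∑ i, h i * g i x‖ₑ ≤ ‖h‖ₑ * ∑ i, ∫⁻ x, ‖g i x‖ₑ := by
  calc ∫⁻ x, ‖∑ i, h i * g i x‖ₑ ≤ ∫⁻ x, ∑ i, ‖h‖ₑ * ‖g i x‖ₑ := by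
        refine lintegral_mono fun x => (enorm_sum_le _ _).trans (Finset.sum_le_sum fun i _ => ?_)
        rw [enorm_mul]
        exact mul_le_mul_left (enorm_apply_le h i) _
    _ = ‖h‖ₑ * ∑ i, ∫⁻ x, ‖g i x‖ₑ := by
        rw [lintegral_finsetSum' _ fun i _ => (hg i).aestronglyMeasurable.enorm.const_mul _,
          Finset.mul_sum]
        exact Finset.sum_congr rfl fun i _ =>
          lintegral_const_mul'' _ (hg i).aestronglyMeasurable.enorm

variable {n : ℕ}

theorem add_smul_mem_box {R ε r : ℝ} {x h : E (n + 1)} (hx : x ∈ box n R ε) (hh : ‖h‖ ≤ r)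
    {t : ℝ} (ht : |t| ≤ 1) : x + t • h ∈ box n (R + r) (ε - r) := by
  refine add_mem_box hx ?_
  rw [norm_smul, Real.norm_eq_abs]
  exact (mul_le_of_le_one_left (norm_nonneg _) ht).trans hh

/-- First and second differences of `H²` functions are of first and second order in `L¹`. -/
theorem MemH2.exists_lintegral_box_difference_le {ψ : E (n + 1) → ℝ} (hψ : MemH2 (Omega n) ψ)
    (R : ℝ) {ε : ℝ} (hε : 0 < ε) : ∃ C : ℝ≥0∞, C ≠ ⊤ ∧ ∀ h : E (n + 1), ‖h‖ ≤ ε / 4 →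
      ∫⁻ x in box n R ε, ‖ψ (x + h) - ψ x‖ₑ ≤ C * ‖h‖ₑ ∧
      ∫⁻ x in box n R ε, ‖ψ (x + h) + ψ (x - h) - 2 * ψ x‖ₑ ≤ C * ‖h‖ₑ ^ 2 := by
  obtain ⟨-, g, g', hg, hg'⟩ := hψ
  set r := ε / 4 with hr
  -- Nested boxes leave room for one displacement of length at most `ε / 4` at each order of
  -- differentiation; the largest still has height above `ε / 2`.
  set V := box n R ε with hVdef
  set V' := box n (R + r) (ε - r) with hV'def
  set W := box n (R + r + r) (ε - r - r) with hWdef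
  have hr0 : 0 < r := by positivity
  have hWε : 0 < ε - r - r := by rw [hr]; linarith
  have hW : MeasurableSet W := (isOpen_box _ _).measurableSet
  have hWΩ : W ⊆ Omega n := box_subset_Omega hWε.le
  have iu : IntegrableOn ψ W := integrableOn_box (hg 0).1.locInt_left _ hWε
  have ig : ∀ i, IntegrableOn (g i) W := fun i => integrableOn_box (hg i).1.locInt_right _ hWε
  have ig' : ∀ i j, IntegrableOn (g' i j) W := fun i j =>
    integrableOn_box (hg' i j).1.locInt_right _ hWε
  have Iu : Integrable (W.indicator ψ) := iu.integrable_indicator hW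
  have Ig : ∀ i, Integrable (W.indicator (g i)) := fun i => (ig i).integrable_indicator hW
  have Ig' : ∀ i j, Integrable (W.indicator (g' i j)) := fun i j =>
    (ig' i j).integrable_indicator hW
  have iw : ∀ h : E (n + 1), Integrable fun x => ∑ i, h i * W.indicator (g i) x := fun h =>
    integrable_finsetSum _ fun i _ => (Ig i).const_mul _
  have iw'i : ∀ (h : E (n + 1)) i, Integrable fun x => ∑ j, h j * W.indicator (g' i j) x :=
    fun h i => integrable_finsetSum _ fun j _ => (Ig' i j).const_mul _
  have iw' : ∀ h : E (n + 1),
      Integrable fun x => ∑ i, h i * ∑ j, h j * W.indicator (g' i j) x := fun h =>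
    integrable_finsetSum _ fun i _ => (iw'i h i).const_mul _
  set C1 : ℝ≥0∞ := ∑ i, ∫⁻ x, ‖W.indicator (g i) x‖ₑ with hC1
  set C2 : ℝ≥0∞ := ∑ i, ∑ j, ∫⁻ x, ‖W.indicator (g' i j) x‖ₑ with hC2
  have hC1t : C1 ≠ ⊤ := ENNReal.sum_ne_top.2 fun i _ => (Ig i).hasFiniteIntegral.ne
  have hC2t : C2 ≠ ⊤ := ENNReal.sum_ne_top.2 fun i _ => ENNReal.sum_ne_top.2 fun j _ =>
    (Ig' i j).hasFiniteIntegral.ne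
  refine ⟨C1 + C2, ENNReal.add_ne_top.2 ⟨hC1t, hC2t⟩, fun h hh => ?_⟩
  have D1 := HasWeakPartial.weakDirDeriv hW hWΩ (fun i => (hg i).1) iu ig h
  have D2 := WeakDirDeriv.sum (fun i => HasWeakPartial.weakDirDeriv hW hWΩ (fun j => (hg' i j).1)
    (ig i) (ig' i) h) Ig (iw'i h) (fun i => h i)
  have hVV' : ∀ x ∈ V, ∀ t : ℝ, |t| ≤ 1 → x + t • h ∈ V' := fun x hx t ht =>
    add_smul_mem_box hx hh ht
  have hV'W : ∀ x ∈ V', ∀ t : ℝ, |t| ≤ 1 → x + t • h ∈ W := fun x hx t ht =>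
    add_smul_mem_box hx hh ht
  have t01 : ∀ t ∈ Icc (0 : ℝ) 1, |t| ≤ 1 := fun t ht =>
    abs_le.2 ⟨by linarith [ht.1], ht.2⟩
  have t10 : ∀ t ∈ Icc (-1 : ℝ) 0, |t| ≤ 1 := fun t ht =>
    abs_le.2 ⟨ht.1, by linarith [ht.2]⟩
  have hV'W' : V' ⊆ W := box_mono (by linarith) (by linarith)
  have m0 : ∀ x ∈ V, W.indicator ψ x = ψ x := fun x hx =>
    indicator_of_mem (box_mono (by linarith) (by linarith) hx) _
  have m1 : ∀ x ∈ V, W.indicator ψ (x + h) = ψ (x + h) := fun x hx =>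
    indicator_of_mem (hV'W' (by simpa using hVV' x hx 1 (by simp))) _
  have m2 : ∀ x ∈ V, W.indicator ψ (x - h) = ψ (x - h) := fun x hx =>
    indicator_of_mem (hV'W' (by simpa [sub_eq_add_neg] using hVV' x hx (-1) (by simp))) _
  have hVm : MeasurableSet V := (isOpen_box _ _).measurableSet
  constructor
  · calc ∫⁻ x in V, ‖ψ (x + h) - ψ x‖ₑ
        = ∫⁻ x in V, ‖W.indicator ψ (x + h) - W.indicator ψ x‖ₑ :=
          setLIntegral_congr_fun hVm fun x hx => by simp only [m0 x hx, m1 x hx]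
      _ ≤ ∫⁻ x, ‖∑ i, h i * W.indicator (g i) x‖ₑ :=
          D1.lintegral_sub_le (isOpen_box _ _) Iu (iw h) fun x hx t ht =>
            hV'W x (box_mono (by linarith) (by linarith) hx) t (t01 t ht)
      _ ≤ ‖h‖ₑ * C1 := lintegral_enorm_sum_mul_le h Ig
      _ ≤ (C1 + C2) * ‖h‖ₑ := by rw [mul_comm]; gcongr; exact le_self_add
  · calc ∫⁻ x in V, ‖ψ (x + h) + ψ (x - h) - 2 * ψ x‖ₑ
        = ∫⁻ x in V, ‖W.indicator ψ (x + h) + W.indicator ψ (x - h) - 2 * W.indicator ψ x‖ₑ :=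
          setLIntegral_congr_fun hVm fun x hx => by simp only [m0 x hx, m1 x hx, m2 x hx]
      _ ≤ ∫⁻ x, ‖∑ i, h i * ∑ j, h j * W.indicator (g' i j) x‖ₑ :=
          D1.lintegral_second_difference_le (isOpen_box _ _) (isOpen_box _ _) D2 Iu (iw h) (iw' h)
            (fun x hx t ht => hVV' x hx t (t10 t ht)) (fun x hx t ht => hV'W x hx t (t01 t ht))
      _ ≤ ‖h‖ₑ * ∑ i, ∫⁻ x, ‖∑ j, h j * W.indicator (g' i j) x‖ₑ :=
          lintegral_enorm_sum_mul_le h (iw'i h)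
      _ ≤ ‖h‖ₑ * ∑ i, (‖h‖ₑ * ∑ j, ∫⁻ x, ‖W.indicator (g' i j) x‖ₑ) := by
          gcongr with i
          exact lintegral_enorm_sum_mul_le h (Ig' i)
      _ = C2 * ‖h‖ₑ ^ 2 := by rw [← Finset.mul_sum, ← mul_assoc, mul_comm, sq]
      _ ≤ (C1 + C2) * ‖h‖ₑ ^ 2 := by gcongr; exact le_add_self

/-- Permits passage to a measurable representative, as joint measurability in `(x, h)` requires. -/
theorem MemH2.congr {ψ u : E (n + 1) → ℝ} (hψ : MemH2 (Omega n) ψ)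
    (h : ψ =ᵐ[volume.restrict (Omega n : Set (E (n + 1)))] u) : MemH2 (Omega n) u := by
  obtain ⟨h2, g, g', hg, hg'⟩ := hψ
  have hu2 := h2.ae_eq h
  refine ⟨hu2, g, g', fun i => ⟨⟨?_, (hg i).1.locInt_right, fun φ => ?_⟩, (hg i).2⟩, hg'⟩
  · rw [locallyIntegrableOn_iff (Omega n).isOpen.isLocallyClosed]
    intro K hK hKc
    exact (((locallyIntegrableOn_iff (Omega n).isOpen.isLocallyClosed).1
      (hg i).1.locInt_left) K hK hKc).congr (ae_restrict_of_ae_restrict_of_subset hK h)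
  · rw [← (hg i).1.integral_eq φ]
    refine integral_congr_ae (h.mono fun x hx => ?_)
    simp only [hx]

end SobolevDifferences

/-! ### Joint integrability in the point and the displacement. -/

section JointIntegrability

variable {n : ℕ}

/-- An `H²` function on the half space with arbitrary `L²` boundary data. -/
structure Admissible (u : E (n + 1) → ℝ) (τ : E n → ℝ) : Prop where
  measurable_left : Measurable u
  measurable_right : Measurable τ
  memH2 : MemH2 (Omega n) u
  memLp_right : MemLp τ 2 volume

/-- The value `ũ(x + h, h)` of the extension seen from `x` at displacement `h`. -/
def extShift (u : E (n + 1) → ℝ) (τ : E n → ℝ) (x h : E (n + 1)) : ℝ := extend u τ (x + h) h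

theorem measurable_extShift {u : E (n + 1) → ℝ} {τ : E n → ℝ} (hu : Measurable u)
    (hτ : Measurable τ) :
    Measurable (fun q : E (n + 1) × E (n + 1) => extShift u τ q.1 q.2) :=
  (measurable_extend hu hτ).comp
    (f := fun q : E (n + 1) × E (n + 1) => (q.1 + q.2, q.2)) (by fun_prop)

theorem lintegral_sq_lt_top_of_memLp {N : ℕ} {μ : Measure (E N)} {f : E N → ℝ}
    (hf : MemLp f 2 μ) : ∫⁻ x, ‖f x‖ₑ ^ 2 ∂μ < ⊤ := by
  have := lintegral_rpow_enorm_lt_top_of_eLpNorm_lt_top two_ne_zero ENNReal.ofNat_ne_top hf.2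
  simpa using this

theorem enorm_le_one_add_sq (a : ℝ) : ‖a‖ₑ ≤ 1 + ‖a‖ₑ ^ 2 := by
  rcases le_total ‖a‖ₑ 1 with h | h
  · exact h.trans le_self_add
  · calc ‖a‖ₑ = ‖a‖ₑ * 1 := (mul_one _).symm
      _ ≤ ‖a‖ₑ * ‖a‖ₑ := by gcongr
      _ = ‖a‖ₑ ^ 2 := (sq _).symm
      _ ≤ 1 + ‖a‖ₑ ^ 2 := le_add_self

/-- The constant in the slab bounds of the extension. -/
def slabConst (u : E (n + 1) → ℝ) (τ : E n → ℝ) (l : ℝ) : ℝ≥0∞ :=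
  (∫⁻ y in Omega n, ‖u y‖ₑ ^ 2) + ENNReal.ofReal l * ∫⁻ z, ‖τ z‖ₑ ^ 2

theorem Admissible.slabConst_ne_top {u : E (n + 1) → ℝ} {τ : E n → ℝ} (H : Admissible u τ)
    (l : ℝ) : slabConst u τ l ≠ ⊤ :=
  ENNReal.add_ne_top.2 ⟨(lintegral_sq_lt_top_of_memLp H.memH2.1).ne,
    ENNReal.mul_ne_top ENNReal.ofReal_ne_top (lintegral_sq_lt_top_of_memLp H.memLp_right).ne⟩

theorem Admissible.lintegral_extend_le {u : E (n + 1) → ℝ} {τ : E n → ℝ} (H : Admissible u τ)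
    {S : Set (E (n + 1))} {a b : ℝ} (hS : S ⊆ {y | height y ∈ Ioo a b}) (v : E (n + 1)) :
    ∫⁻ y in S, ‖extend u τ y v‖ₑ ≤ volume S + slabConst u τ (b - a) := by
  calc ∫⁻ y in S, ‖extend u τ y v‖ₑ ≤ ∫⁻ y in S, (1 + ‖extend u τ y v‖ₑ ^ 2) :=
        lintegral_mono fun y => enorm_le_one_add_sq _
    _ = volume S + ∫⁻ y in S, ‖extend u τ y v‖ₑ ^ 2 := by
        rw [lintegral_add_left measurable_const]; simp
    _ ≤ volume S + slabConst u τ (b - a) := by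
        gcongr
        exact (lintegral_mono_set hS).trans
          (lintegral_slab_extend_le H.measurable_left H.measurable_right a b v)

/-- The box translated by `h` lies in a slab of width `2 * R` and keeps its volume, so the bound is
uniform in `h`. -/
theorem Admissible.lintegral_box_extShift_le {u : E (n + 1) → ℝ} {τ : E n → ℝ}
    (H : Admissible u τ) (R ε : ℝ) (h : E (n + 1)) :
    ∫⁻ x in box n R ε, ‖extShift u τ x h‖ₑ
      ≤ volume (box n R ε) + slabConst u τ (2 * R) := by
  have hmp := measurePreserving_add_right (volume : Measure (E (n + 1))) h
  have he := (Homeomorph.addRight h).measurableEmbedding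
  have hpre : box n R ε = (fun x => x + h) ⁻¹' ((fun x => x - h) ⁻¹' box n R ε) := by
    ext x; simp
  have hvol : volume ((fun x => x - h) ⁻¹' box n R ε) = volume (box n R ε) :=
    (measurePreserving_sub_right volume h).measure_preimage_emb
      (Homeomorph.subRight h).measurableEmbedding _
  have h1 : ∫⁻ x in box n R ε, ‖extShift u τ x h‖ₑ
      = ∫⁻ y in (fun x => x - h) ⁻¹' box n R ε, ‖extend u τ y h‖ₑ := by
    conv_lhs => rw [hpre]
    exact hmp.setLIntegral_comp_preimage_emb he (fun y => ‖extend u τ y h‖ₑ) _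
  rw [h1, ← hvol]
  have h2 := H.lintegral_extend_le (S := (fun x => x - h) ⁻¹' box n R ε) (a := height h - R)
    (b := height h + R) (fun y hy => ?_) h
  · rwa [show height h + R - (height h - R) = 2 * R by ring] at h2
  · have hy1 : ‖y - h‖ < R := hy.1
    have hy2 := abs_lt.1 ((abs_height_le (y - h)).trans_lt hy1)
    have hy3 : height (y - h) = height y - height h := rfl
    rw [hy3] at hy2
    exact ⟨by linarith, by linarith⟩

/-- The central estimate. For short `h` the points `x ± h` remain in `Ω`, the extension is `u`
itself and the Sobolev differences apply; otherwise the triangle inequality and the uniform bound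
suffice, since both weights are then bounded below. -/
theorem Admissible.exists_difference_le {u : E (n + 1) → ℝ} {τ : E n → ℝ}
    (H : Admissible u τ) (R : ℝ) {ε : ℝ} (hε : 0 < ε) :
    ∃ C : ℝ≥0∞, C ≠ ⊤ ∧ ∀ h : E (n + 1),
      ∫⁻ x in box n R ε, ‖extShift u τ x h - u x‖ₑ ≤ C * ENNReal.ofReal (min ‖h‖ 1) ∧
      ∫⁻ x in box n R ε, ‖extShift u τ x h + extShift u τ x (-h) - 2 * u x‖ₑ
        ≤ C * ENNReal.ofReal (‖h‖ * min ‖h‖ 1) := by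
  obtain ⟨C, hCt, hC⟩ := H.memH2.exists_lintegral_box_difference_le R hε
  have hB : MeasurableSet (box n R ε) := (isOpen_box _ _).measurableSet
  set M : ℝ≥0∞ := volume (box n R ε) + slabConst u τ (2 * R) with hM
  have hMt : M ≠ ⊤ := ENNReal.add_ne_top.2 ⟨(volume_box_lt_top R ε).ne, H.slabConst_ne_top _⟩
  set M0 : ℝ≥0∞ := ∫⁻ x in box n R ε, ‖u x‖ₑ with hM0
  have hM0t : M0 ≠ ⊤ := by
    have := integrableOn_box (H.memH2.2.choose_spec.choose_spec.1 0).1.locInt_left R hε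
    exact this.hasFiniteIntegral.ne
  set L : ℝ≥0∞ := M + M + 2 * M0 with hL
  have hLt : L ≠ ⊤ := by finiteness
  set m := min (ε / 4) 1 with hm
  have hm0 : 0 < m := lt_min (by positivity) one_pos
  have hm1 : m ≤ 1 := min_le_right _ _
  have hmm : ENNReal.ofReal (m * m) ≠ 0 := by simp [hm0]
  have meas : ∀ h : E (n + 1), Measurable fun x => ‖extShift u τ x h‖ₑ := fun h =>
    ((measurable_extShift H.measurable_left H.measurable_right).comp
      (f := fun x : E (n + 1) => (x, h)) (by fun_prop)).enorm
  -- For `‖h‖ ≥ m` both weights are at least `m * m`, as `m ≤ 1`, so dividing the crude bound `L` by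
  -- `m * m` absorbs them.
  refine ⟨C + L / ENNReal.ofReal (m * m),
    ENNReal.add_ne_top.2 ⟨hCt, ENNReal.div_ne_top hLt hmm⟩, fun h => ?_⟩
  rcases le_total ‖h‖ m with hh | hh
  · have hmin : min ‖h‖ 1 = ‖h‖ := min_eq_left (hh.trans hm1)
    have hh4 : ‖h‖ ≤ ε / 4 := hh.trans (min_le_left _ _)
    have e1 : ∀ x ∈ box n R ε, ∀ h : E (n + 1), ‖h‖ ≤ ε / 4 →
        extShift u τ x h = u (x + h) := fun x hx h hh => by
      refine extend_of_pos u τ h ?_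
      have := (add_mem_box hx hh).2
      linarith
    rw [hmin, ← sq ‖h‖, ENNReal.ofReal_pow (norm_nonneg _), ofReal_norm]
    constructor
    · calc ∫⁻ x in box n R ε, ‖extShift u τ x h - u x‖ₑ
          = ∫⁻ x in box n R ε, ‖u (x + h) - u x‖ₑ :=
            setLIntegral_congr_fun hB fun x hx => by simp only [e1 x hx h hh4]
        _ ≤ C * ‖h‖ₑ := (hC h hh4).1
        _ ≤ _ := by gcongr; exact le_self_add
    · calc ∫⁻ x in box n R ε, ‖extShift u τ x h + extShift u τ x (-h) - 2 * u x‖ₑ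
          = ∫⁻ x in box n R ε, ‖u (x + h) + u (x - h) - 2 * u x‖ₑ :=
            setLIntegral_congr_fun hB fun x hx => by
              simp only [e1 x hx h hh4, e1 x hx (-h) (by rwa [norm_neg]), sub_eq_add_neg]
        _ ≤ C * ‖h‖ₑ ^ 2 := (hC h hh4).2
        _ ≤ _ := by gcongr; exact le_self_add
  · have hmin : m ≤ min ‖h‖ 1 := le_min hh hm1
    have key : ∀ r : ℝ, m * m ≤ r →
        L ≤ (C + L / ENNReal.ofReal (m * m)) * ENNReal.ofReal r := fun r hr =>
      calc L = L / ENNReal.ofReal (m * m) * ENNReal.ofReal (m * m) :=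
            (ENNReal.div_mul_cancel hmm ENNReal.ofReal_ne_top).symm
        _ ≤ (C + L / ENNReal.ofReal (m * m)) * ENNReal.ofReal r := by
            gcongr; exact le_add_self
    constructor
    · refine le_trans ?_ (key _ (by nlinarith))
      calc ∫⁻ x in box n R ε, ‖extShift u τ x h - u x‖ₑ
          ≤ ∫⁻ x in box n R ε, (‖extShift u τ x h‖ₑ + ‖u x‖ₑ) :=
            lintegral_mono fun x => enorm_sub_le
        _ = (∫⁻ x in box n R ε, ‖extShift u τ x h‖ₑ) + M0 := lintegral_add_left (meas h) _
        _ ≤ M + 2 * M0 := by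
            gcongr
            · exact H.lintegral_box_extShift_le R ε h
            · rw [two_mul]; exact le_self_add
        _ ≤ L := by
            rw [hL]
            gcongr
            exact le_self_add
    · refine le_trans ?_ (key _ (mul_le_mul hh hmin hm0.le (norm_nonneg _)))
      calc ∫⁻ x in box n R ε, ‖extShift u τ x h + extShift u τ x (-h) - 2 * u x‖ₑ
          ≤ ∫⁻ x in box n R ε, (‖extShift u τ x h‖ₑ + ‖extShift u τ x (-h)‖ₑ + 2 * ‖u x‖ₑ) := by
            refine lintegral_mono fun x => enorm_sub_le.trans (add_le_add (enorm_add_le _ _) ?_)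
            rw [enorm_mul]
            exact mul_le_mul_left (by simp [Real.enorm_eq_ofReal]) _
        _ = (∫⁻ x in box n R ε, ‖extShift u τ x h‖ₑ)
            + (∫⁻ x in box n R ε, ‖extShift u τ x (-h)‖ₑ) + 2 * M0 := by
            have h2 : Measurable fun x => ‖extShift u τ x h‖ₑ + ‖extShift u τ x (-h)‖ₑ :=
              (meas h).add (meas (-h))
            rw [lintegral_add_left h2, lintegral_add_left (meas h),
              lintegral_const_mul _ H.measurable_left.enorm]
        _ ≤ L := by
            rw [hL]
            gcongr
            · exact H.lintegral_box_extShift_le R ε h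
            · exact H.lintegral_box_extShift_le R ε (-h)

/-- The kernel controlling all the integrals near zero and near infinity. -/
theorem integrable_kernel {s : ℝ} (hs : 1 / 2 < s) (hs' : s < 1) :
    Integrable fun h : E (n + 1) =>
      ‖h‖ * min ‖h‖ 1 / ‖h‖ ^ (((n + 1 : ℕ) : ℝ) + 2 * s) := by
  rw [integrable_fun_norm_addHaar (volume : Measure (E (n + 1)))
    (f := fun r : ℝ => r * min r 1 / r ^ (((n + 1 : ℕ) : ℝ) + 2 * s))]
  simp only [finrank_euclideanSpace, Fintype.card_fin, Nat.add_sub_cancel, smul_eq_mul]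
  have hpow : ∀ r : ℝ, 0 < r → ∀ a : ℝ, r ^ n * (r * r ^ a / r ^ (((n + 1 : ℕ) : ℝ) + 2 * s))
      = r ^ (a - 2 * s) := by
    intro r hr a
    rw [← Real.rpow_natCast, mul_div_assoc', div_eq_mul_inv, ← Real.rpow_neg hr.le]
    nth_rewrite 2 [← Real.rpow_one r]
    rw [← Real.rpow_add hr, ← Real.rpow_add hr, ← Real.rpow_add hr]
    congr 1
    push_cast
    ring
  rw [← Ioc_union_Ioi_eq_Ioi zero_le_one]
  refine IntegrableOn.union ?_ ?_
  · have h1 : IntegrableOn (fun r : ℝ => r ^ (1 - 2 * s)) (Ioc 0 1) :=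
      (intervalIntegrable_iff_integrableOn_Ioc_of_le zero_le_one).1
        (intervalIntegral.intervalIntegrable_rpow' (by linarith))
    refine h1.congr_fun (fun r hr => ?_) measurableSet_Ioc
    simp only
    rw [min_eq_left hr.2, ← hpow r hr.1 1, Real.rpow_one]
  · have h1 : IntegrableOn (fun r : ℝ => r ^ (0 - 2 * s)) (Ioi 1) :=
      integrableOn_Ioi_rpow_of_lt (by linarith) one_pos
    refine h1.congr_fun (fun r hr => ?_) measurableSet_Ioi
    have hr1 : 1 < r := hr
    simp only
    rw [min_eq_right hr1.le, ← hpow r (one_pos.trans hr1) 0, Real.rpow_zero]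

/-- Tonelli with the `x`-integral inside: the weight `κ` is constant there, and the bound `m`
compensates its singularity. -/
theorem integrable_prod_of_lintegral_le {N : ℕ} {S : Set (E N)} {f : E N × E N → ℝ}
    (hf : Measurable f) {κ m : E N → ℝ} (hκ : Measurable κ)
    {C : ℝ≥0∞} (hCt : C ≠ ⊤)
    (hC : ∀ h, ∫⁻ x in S, ‖f (x, h)‖ₑ ≤ C * ENNReal.ofReal (m h)) (hm0 : ∀ h, 0 ≤ m h)
    (hm : Integrable fun h => m h * κ h) :
    Integrable (fun q : E N × E N => f q * κ q.2) ((volume.restrict S).prod volume) := by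
  have hmeas : Measurable fun q : E N × E N => f q * κ q.2 := by fun_prop
  refine ⟨hmeas.aestronglyMeasurable, ?_⟩
  rw [hasFiniteIntegral_iff_enorm, lintegral_prod_symm' _ hmeas.enorm]
  calc ∫⁻ h, ∫⁻ x in S, ‖f (x, h) * κ h‖ₑ
      ≤ ∫⁻ h, C * ‖m h * κ h‖ₑ := by
        refine lintegral_mono fun h => ?_
        simp only [enorm_mul]
        rw [lintegral_mul_const _ (by fun_prop), Real.enorm_of_nonneg (hm0 h), ← mul_assoc]
        exact mul_le_mul_left (hC h) _
    _ = C * ∫⁻ h, ‖m h * κ h‖ₑ := lintegral_const_mul' _ _ hCt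
    _ < ⊤ := ENNReal.mul_lt_top hCt.lt_top hm.hasFiniteIntegral

theorem Admissible.integrable_prod_difference {u : E (n + 1) → ℝ} {τ : E n → ℝ}
    (H : Admissible u τ) {s : ℝ} (hs : 1 / 2 < s) (hs' : s < 1) (R : ℝ) {ε : ℝ} (hε : 0 < ε) :
    Integrable (fun q : E (n + 1) × E (n + 1) => (extShift u τ q.1 q.2 - u q.1)
      * (‖q.2‖ / ‖q.2‖ ^ (((n + 1 : ℕ) : ℝ) + 2 * s)))
      ((volume.restrict (box n R ε)).prod volume) := by
  obtain ⟨C, hCt, hC⟩ := H.exists_difference_le R hε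
  refine integrable_prod_of_lintegral_le (m := fun h => min ‖h‖ 1)
    (f := fun q => extShift u τ q.1 q.2 - u q.1)
    (κ := fun h => ‖h‖ / ‖h‖ ^ (((n + 1 : ℕ) : ℝ) + 2 * s)) ?_ (by fun_prop)
    hCt (fun h => (hC h).1) (fun h => by positivity) ?_
  · exact (measurable_extShift H.measurable_left H.measurable_right).sub
      (H.measurable_left.comp measurable_fst)
  · refine (integrable_kernel hs hs').congr (Eventually.of_forall fun h => ?_)
    simp only
    ring

theorem Admissible.integrable_prod_second_difference {u : E (n + 1) → ℝ} {τ : E n → ℝ}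
    (H : Admissible u τ) {s : ℝ} (hs : 1 / 2 < s) (hs' : s < 1) (R : ℝ) {ε : ℝ} (hε : 0 < ε) :
    Integrable (fun q : E (n + 1) × E (n + 1) =>
      (extShift u τ q.1 q.2 + extShift u τ q.1 (-q.2) - 2 * u q.1)
      * (‖q.2‖ ^ (((n + 1 : ℕ) : ℝ) + 2 * s))⁻¹)
      ((volume.restrict (box n R ε)).prod volume) := by
  obtain ⟨C, hCt, hC⟩ := H.exists_difference_le R hε
  refine integrable_prod_of_lintegral_le (m := fun h => ‖h‖ * min ‖h‖ 1)
    (f := fun q => extShift u τ q.1 q.2 + extShift u τ q.1 (-q.2) - 2 * u q.1)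
    (κ := fun h => (‖h‖ ^ (((n + 1 : ℕ) : ℝ) + 2 * s))⁻¹) ?_ (by fun_prop)
    hCt (fun h => (hC h).2) (fun h => by positivity)
    ((integrable_kernel hs hs').congr (Eventually.of_forall fun h => div_eq_mul_inv _ _))
  have hX := measurable_extShift H.measurable_left H.measurable_right
  exact (hX.add (hX.comp (f := fun q : E (n + 1) × E (n + 1) => (q.1, -q.2)) (by fun_prop))).sub
    ((H.measurable_left.comp measurable_fst).const_mul 2)

end JointIntegrability

/-! ### Almost everywhere convergence and the principal value. -/

section Pointwise

variable {n : ℕ}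

/-- The integrand of the nonlocal gradient in terms of the displacement `h = y - x`. -/
def gradDensity (s : ℝ) (u : E (n + 1) → ℝ) (τ : E n → ℝ) (x h : E (n + 1)) : E (n + 1) :=
  ((extShift u τ x h - u x) / ‖h‖ ^ (((n + 1 : ℕ) : ℝ) + 2 * s)) • h

/-- The symmetrized integrand of the operator in terms of the displacement `h = y - x`. -/
def symmDensity (s : ℝ) (u : E (n + 1) → ℝ) (τ : E n → ℝ) (x h : E (n + 1)) : ℝ :=
  (extShift u τ x h + extShift u τ x (-h) - 2 * u x) * (‖h‖ ^ (((n + 1 : ℕ) : ℝ) + 2 * s))⁻¹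

theorem measurable_gradDensity (s : ℝ) {u : E (n + 1) → ℝ} {τ : E n → ℝ} (hu : Measurable u)
    (hτ : Measurable τ) :
    Measurable fun q : E (n + 1) × E (n + 1) => gradDensity s u τ q.1 q.2 :=
  (((measurable_extShift hu hτ).sub (hu.comp measurable_fst)).div (by fun_prop)).smul
    measurable_snd

theorem norm_gradDensity (s : ℝ) (u : E (n + 1) → ℝ) (τ : E n → ℝ) (x h : E (n + 1)) :
    ‖gradDensity s u τ x h‖ = ‖(extShift u τ x h - u x)
      * (‖h‖ / ‖h‖ ^ (((n + 1 : ℕ) : ℝ) + 2 * s))‖ := by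
  rw [gradDensity, norm_smul, norm_div, norm_mul, norm_div, norm_norm]
  ring

theorem Admissible.integrable_gradDensity {u : E (n + 1) → ℝ} {τ : E n → ℝ}
    (H : Admissible u τ) {s : ℝ} (hs : 1 / 2 < s) (hs' : s < 1) (R : ℝ) {ε : ℝ} (hε : 0 < ε) :
    Integrable (fun q : E (n + 1) × E (n + 1) => gradDensity s u τ q.1 q.2)
      ((volume.restrict (box n R ε)).prod volume) :=
  (H.integrable_prod_difference hs hs' R hε).mono
    (measurable_gradDensity s H.measurable_left H.measurable_right).aestronglyMeasurable
    (Eventually.of_forall fun q => (norm_gradDensity s u τ q.1 q.2).le)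

theorem ae_Omega_of_forall_box {P : E (n + 1) → Prop}
    (h : ∀ R ε : ℝ, 0 < ε → ∀ᵐ x ∂(volume.restrict (box n R ε)), P x) :
    ∀ᵐ x ∂(volume.restrict (Omega n : Set (E (n + 1)))), P x := by
  have hsub : (Omega n : Set (E (n + 1))) ⊆ ⋃ k : ℕ, box n k (1 / (k + 1)) := by
    intro x hx
    have hx0 : 0 < height x := hx
    obtain ⟨k, hk⟩ := exists_nat_one_div_lt hx0
    obtain ⟨m, hm⟩ := exists_nat_gt ‖x‖
    refine mem_iUnion.2 ⟨max k m, hm.trans_le (by exact_mod_cast le_max_right k m),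
      lt_of_le_of_lt ?_ hk⟩
    refine one_div_le_one_div_of_le (by positivity) ?_
    have : (k : ℝ) ≤ (max k m : ℕ) := by exact_mod_cast le_max_left k m
    linarith
  refine ae_restrict_of_ae_restrict_of_subset hsub ?_
  rw [ae_restrict_iUnion_iff]
  exact fun k => h _ _ (by positivity)

theorem Admissible.ae_integrable_gradDensity {u : E (n + 1) → ℝ} {τ : E n → ℝ}
    (H : Admissible u τ) {s : ℝ} (hs : 1 / 2 < s) (hs' : s < 1) :
    ∀ᵐ x ∂(volume.restrict (Omega n : Set (E (n + 1)))), Integrable (gradDensity s u τ x) :=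
  ae_Omega_of_forall_box fun R _ hε => (H.integrable_gradDensity hs hs' R hε).prod_right_ae

theorem Admissible.ae_integrable_symmDensity {u : E (n + 1) → ℝ} {τ : E n → ℝ}
    (H : Admissible u τ) {s : ℝ} (hs : 1 / 2 < s) (hs' : s < 1) :
    ∀ᵐ x ∂(volume.restrict (Omega n : Set (E (n + 1)))), Integrable (symmDensity s u τ x) :=
  ae_Omega_of_forall_box fun R _ hε =>
    (H.integrable_prod_second_difference hs hs' R hε).prod_right_ae

/-- Dominated convergence by `‖f‖`. The origin belongs to no truncated domain with `δ > 0`, and `f 0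
= 0` settles convergence there. -/
theorem tendsto_setIntegral_lt_norm {N : ℕ} {f : E N → ℝ} (hf : Integrable f) (h0 : f 0 = 0) :
    Tendsto (fun δ : ℝ => ∫ h in {h | δ < ‖h‖}, f h) (𝓝[>] 0) (𝓝 (∫ h, f h)) := by
  have hm : ∀ δ : ℝ, MeasurableSet {h : E N | δ < ‖h‖} := fun δ =>
    measurableSet_lt measurable_const measurable_norm
  simp only [← integral_indicator (hm _)]
  refine tendsto_integral_filter_of_dominated_convergence (fun h => ‖f h‖)
    (Eventually.of_forall fun δ => hf.aestronglyMeasurable.indicator (hm δ))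
    (Eventually.of_forall fun δ => Eventually.of_forall fun h => norm_indicator_le_norm_self _ _)
    hf.norm (Eventually.of_forall fun h => ?_)
  rcases eq_or_ne h 0 with rfl | hh
  · refine tendsto_const_nhds.congr fun δ => ?_
    simp [indicator, h0]
  · refine tendsto_const_nhds.congr' ?_
    filter_upwards [Ioo_mem_nhdsGT (norm_pos_iff.2 hh)] with δ hδ
    exact (indicator_of_mem (show h ∈ {h : E N | δ < ‖h‖} from hδ.2) f).symm

/-- The truncated domain is invariant under `h ↦ -h`; this replaces first differences by second
ones, which are integrable up to the origin. -/
theorem setIntegral_lt_norm_eq_half {N : ℕ} {f : E N → ℝ} {δ : ℝ}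
    (hf : IntegrableOn f {h | δ < ‖h‖}) :
    ∫ h in {h | δ < ‖h‖}, f h = 1 / 2 * ∫ h in {h | δ < ‖h‖}, (f h + f (-h)) := by
  have hm : MeasurableSet {h : E N | δ < ‖h‖} :=
    measurableSet_lt measurable_const measurable_norm
  have hpre : (fun h : E N => -h) ⁻¹' {h | δ < ‖h‖} = {h | δ < ‖h‖} := by
    ext h; simp
  have hmp := Measure.measurePreserving_neg (volume : Measure (E N))
  have he := (Homeomorph.neg (E N)).measurableEmbedding
  have h1 : IntegrableOn (fun h => f (-h)) {h | δ < ‖h‖} := by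
    have := (hmp.integrableOn_comp_preimage he (f := f) (s := {h | δ < ‖h‖})).2 hf
    rwa [hpre] at this
  have h2 : ∫ h in {h | δ < ‖h‖}, f (-h) = ∫ h in {h | δ < ‖h‖}, f h := by
    have := hmp.setIntegral_preimage_emb he f {h | δ < ‖h‖}
    rwa [hpre] at this
  rw [integral_add hf h1, h2]
  ring

/-- Both sides use the boundary data `trace ψ`, so they can differ only on a null subset of `Ω` that
does not depend on `x`. -/
theorem ae_ext_eq {ψ u : E (n + 1) → ℝ}
    (h : ψ =ᵐ[volume.restrict (Omega n : Set (E (n + 1)))] u) (x : E (n + 1)) :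
    ∀ᵐ y, ext ψ y (y - x) = extShift u (trace ψ) x (y - x) := by
  rw [EventuallyEq, ae_restrict_iff' (Omega n).isOpen.measurableSet] at h
  filter_upwards [h] with y hy
  rw [extShift, add_sub_cancel, ext_eq_extend]
  by_cases hy0 : 0 < height y
  · rw [extend_of_pos _ _ _ hy0, extend_of_pos _ _ _ hy0]
    exact hy hy0
  · simp only [extend, if_neg hy0]

theorem ae_gradKernel_eq {ψ u : E (n + 1) → ℝ} (s : ℝ)
    (h : ψ =ᵐ[volume.restrict (Omega n : Set (E (n + 1)))] u) {x : E (n + 1)}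
    (hx : ψ x = u x) :
    gradKernel s ψ x =ᵐ[volume] fun y => gradDensity s u (trace ψ) x (y - x) := by
  filter_upwards [ae_ext_eq h x] with y hy
  rw [gradKernel, gradDensity, hy, hx]

/-- The convergence of the integrals at a point, and the value of the principal value. -/
theorem integrable_and_tendsto_of_densities {ψ u : E (n + 1) → ℝ} {s : ℝ} (hs : 1 / 2 < s)
    (h : ψ =ᵐ[volume.restrict (Omega n : Set (E (n + 1)))] u) {x : E (n + 1)}
    (hx : ψ x = u x) (hu : Measurable u)
    (hg : Integrable (gradDensity s u (trace ψ) x)) (hq : Integrable (symmDensity s u (trace ψ) x))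
    (γ ν₀ : ℝ) :
    (∀ δ : ℝ, 0 < δ → IntegrableOn (opKernel s ψ x) {y | δ < ‖y - x‖} volume) ∧
    Tendsto (fun δ => truncOp γ ν₀ s ψ δ x) (𝓝[>] 0)
      (𝓝 (γ * ν₀ ^ (1 - 2 * s) * Real.Gamma (2 * s + 1)
        * (1 / 2 * ∫ h, symmDensity s u (trace ψ) x h))) := by
  set τ := trace ψ with hτ
  set p : ℝ := ((n + 1 : ℕ) : ℝ) + 2 * s with hp
  set q : E (n + 1) → ℝ := fun h => (extShift u τ x h - u x) / ‖h‖ ^ p with hqdef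
  have hm : ∀ δ : ℝ, MeasurableSet {h : E (n + 1) | δ < ‖h‖} := fun δ =>
    measurableSet_lt measurable_const measurable_norm
  have hqm : Measurable q := by
    refine Measurable.div (((measurable_extShift hu (measurable_trace ψ)).comp
      (f := fun h : E (n + 1) => (x, h)) (by fun_prop)).sub measurable_const) (by fun_prop)
  -- Where `‖h‖ > δ`, the operator integrand is at most `δ⁻¹` times the norm of the gradient
  -- integrand.
  have hqi : ∀ δ : ℝ, 0 < δ → IntegrableOn q {h | δ < ‖h‖} := fun δ hδ => by
    refine Integrable.mono' (g := fun h => δ⁻¹ * ‖gradDensity s u τ x h‖)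
      (hg.norm.const_mul _).integrableOn hqm.aestronglyMeasurable
      ((ae_restrict_iff' (hm δ)).2 (Eventually.of_forall fun h hh => ?_))
    have hh' : δ < ‖h‖ := hh
    rw [gradDensity, norm_smul]
    rw [show δ⁻¹ * (‖(extShift u τ x h - u x) / ‖h‖ ^ p‖ * ‖h‖)
      = ‖q h‖ * (δ⁻¹ * ‖h‖) by rw [hqdef]; ring]
    refine le_mul_of_one_le_right (norm_nonneg _) ?_
    rw [inv_mul_eq_div, one_le_div hδ]
    exact hh'.le
  have hpre : ∀ δ : ℝ, {y : E (n + 1) | δ < ‖y - x‖} = (fun y => y - x) ⁻¹' {h | δ < ‖h‖} :=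
    fun δ => rfl
  have hmp := measurePreserving_sub_right (volume : Measure (E (n + 1))) x
  have he := (Homeomorph.subRight x).measurableEmbedding
  have hop : opKernel s ψ x =ᵐ[volume] fun y => q (y - x) := by
    filter_upwards [ae_ext_eq h x] with y hy
    rw [opKernel, hy, hx]
  have hopi : ∀ δ : ℝ, 0 < δ → IntegrableOn (opKernel s ψ x) {y | δ < ‖y - x‖} volume := by
    intro δ hδ
    rw [hpre]
    have := (hmp.integrableOn_comp_preimage he (f := q) (s := {h | δ < ‖h‖})).2 (hqi δ hδ)
    exact this.congr (ae_restrict_of_ae hop.symm)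
  refine ⟨hopi, Tendsto.const_mul _ ?_⟩
  have hq0 : symmDensity s u τ x 0 = 0 := by
    have hp0 : p ≠ 0 := by rw [hp]; positivity
    rw [symmDensity, norm_zero, ← hp, Real.zero_rpow hp0, inv_zero, mul_zero]
  refine ((tendsto_setIntegral_lt_norm hq hq0).const_mul (1 / 2)).congr' ?_
  filter_upwards [self_mem_nhdsWithin] with δ hδ
  have e1 : ∫ y in {y | δ < ‖y - x‖}, opKernel s ψ x y = ∫ h in {h | δ < ‖h‖}, q h := by
    rw [integral_congr_ae (ae_restrict_of_ae hop), hpre]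
    exact hmp.setIntegral_preimage_emb he q _
  rw [e1, setIntegral_lt_norm_eq_half (hqi δ hδ)]
  congr 1
  refine integral_congr_ae (Eventually.of_forall fun h => ?_)
  simp only [hqdef, symmDensity, norm_neg, ← hp]
  ring

end Pointwise

/-! ### Tested differences and their radial derivative. -/

section Divergence

variable {n : ℕ}

/-- The symmetric second difference of the extension, tested against `φ`. -/
def testedSecondDiff (u : E (n + 1) → ℝ) (τ : E n → ℝ) (B : Set (E (n + 1)))
    (φ : E (n + 1) → ℝ) (h : E (n + 1)) : ℝ :=
  ∫ x in B, (extShift u τ x h + extShift u τ x (-h) - 2 * u x) * φ x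

/-- The symmetric first difference of the extension, tested against `h · ∇φ`. -/
def testedFirstDiff (u : E (n + 1) → ℝ) (τ : E n → ℝ) (B : Set (E (n + 1)))
    (φ : E (n + 1) → ℝ) (h : E (n + 1)) : ℝ :=
  ∫ x in B, (extShift u τ x h - extShift u τ x (-h)) * fderiv ℝ φ x h

theorem norm_le_toReal_mul {a r : ℝ} {C : ℝ≥0∞} (hC : C ≠ ⊤) (hr : 0 ≤ r)
    (h : ‖a‖ₑ ≤ C * ENNReal.ofReal r) : ‖a‖ ≤ C.toReal * r := by
  have := ENNReal.toReal_mono (ENNReal.mul_ne_top hC ENNReal.ofReal_ne_top) h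
  rwa [toReal_enorm, ENNReal.toReal_mul, ENNReal.toReal_ofReal hr] at this

theorem Admissible.integrableOn_extShift {u : E (n + 1) → ℝ} {τ : E n → ℝ}
    (H : Admissible u τ) (R ε : ℝ) (h : E (n + 1)) :
    IntegrableOn (fun x => extShift u τ x h) (box n R ε) :=
  ⟨((measurable_extShift H.measurable_left H.measurable_right).comp
    (f := fun x : E (n + 1) => (x, h)) (by fun_prop)).aestronglyMeasurable,
    (H.lintegral_box_extShift_le R ε h).trans_lt
      (ENNReal.add_lt_top.2 ⟨volume_box_lt_top R ε, (H.slabConst_ne_top _).lt_top⟩)⟩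

theorem Admissible.integrableOn_box_left {u : E (n + 1) → ℝ} {τ : E n → ℝ}
    (H : Admissible u τ) (R : ℝ) {ε : ℝ} (hε : 0 < ε) : IntegrableOn u (box n R ε) :=
  integrableOn_box (H.memH2.2.choose_spec.choose_spec.1 0).1.locInt_left R hε

theorem Admissible.locallyIntegrable_extend {u : E (n + 1) → ℝ} {τ : E n → ℝ}
    (H : Admissible u τ) (v : E (n + 1)) : LocallyIntegrable fun y => extend u τ y v := by
  intro x
  refine ⟨Metric.ball x 1, Metric.ball_mem_nhds x one_pos, ?_, ?_⟩
  · exact ((measurable_extend H.measurable_left H.measurable_right).comp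
      (f := fun y : E (n + 1) => (y, v)) (by fun_prop)).aestronglyMeasurable
  · refine (H.lintegral_extend_le (a := height x - 1) (b := height x + 1) (fun y hy => ?_) v).trans_lt
      (ENNReal.add_lt_top.2 ⟨measure_ball_lt_top, (H.slabConst_ne_top _).lt_top⟩)
    have h1 := abs_lt.1 ((abs_height_le (y - x)).trans_lt (mem_ball_iff_norm.1 hy))
    have h2 : height (y - x) = height y - height x := rfl
    rw [h2] at h1
    exact ⟨by linarith, by linarith⟩

theorem Admissible.exists_norm_testedSecondDiff_le {u : E (n + 1) → ℝ} {τ : E n → ℝ}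
    (H : Admissible u τ) (R : ℝ) {ε : ℝ} (hε : 0 < ε) {φ : E (n + 1) → ℝ}
    (hφ : ContDiff ℝ ∞ φ) (hφc : HasCompactSupport φ) :
    ∃ C : ℝ, ∀ h, ‖testedSecondDiff u τ (box n R ε) φ h‖ ≤ C * (‖h‖ * min ‖h‖ 1) := by
  obtain ⟨C, hCt, hC⟩ := H.exists_difference_le R hε
  obtain ⟨M, hM⟩ := hφ.continuous.bounded_above_of_compact_support hφc
  refine ⟨(C * ENNReal.ofReal M).toReal, fun h => norm_le_toReal_mul (by finiteness)
    (by positivity) ?_⟩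
  calc ‖testedSecondDiff u τ (box n R ε) φ h‖ₑ
      ≤ ∫⁻ x in box n R ε, ‖(extShift u τ x h + extShift u τ x (-h) - 2 * u x) * φ x‖ₑ :=
        enorm_integral_le_lintegral_enorm _
    _ ≤ ∫⁻ x in box n R ε, ‖extShift u τ x h + extShift u τ x (-h) - 2 * u x‖ₑ
          * ENNReal.ofReal M := by
        refine lintegral_mono fun x => ?_
        rw [enorm_mul, ← ofReal_norm (φ x)]
        gcongr
        exact hM x
    _ = (∫⁻ x in box n R ε, ‖extShift u τ x h + extShift u τ x (-h) - 2 * u x‖ₑ)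
          * ENNReal.ofReal M := lintegral_mul_const' _ _ ENNReal.ofReal_ne_top
    _ ≤ C * ENNReal.ofReal (‖h‖ * min ‖h‖ 1) * ENNReal.ofReal M := by
        gcongr; exact (hC h).2
    _ = _ := by ring

theorem Admissible.exists_norm_testedFirstDiff_le {u : E (n + 1) → ℝ} {τ : E n → ℝ}
    (H : Admissible u τ) (R : ℝ) {ε : ℝ} (hε : 0 < ε) {φ : E (n + 1) → ℝ}
    (hφ : ContDiff ℝ ∞ φ) (hφc : HasCompactSupport φ) :
    ∃ C : ℝ, ∀ h, ‖testedFirstDiff u τ (box n R ε) φ h‖ ≤ C * (‖h‖ * min ‖h‖ 1) := by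
  obtain ⟨C, hCt, hC⟩ := H.exists_difference_le R hε
  obtain ⟨M, hM⟩ := exists_norm_fderiv_le hφ hφc
  have hX := measurable_extShift H.measurable_left H.measurable_right
  refine ⟨(2 * C * ENNReal.ofReal M).toReal, fun h => norm_le_toReal_mul (by finiteness)
    (by positivity) ?_⟩
  have hm : Measurable fun x => ‖extShift u τ x h - u x‖ₑ :=
    ((hX.comp (f := fun x : E (n + 1) => (x, h)) (by fun_prop)).sub H.measurable_left).enorm
  calc ‖testedFirstDiff u τ (box n R ε) φ h‖ₑ
      ≤ ∫⁻ x in box n R ε, ‖(extShift u τ x h - extShift u τ x (-h)) * fderiv ℝ φ x h‖ₑ :=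
        enorm_integral_le_lintegral_enorm _
    _ ≤ ∫⁻ x in box n R ε, (‖extShift u τ x h - u x‖ₑ + ‖extShift u τ x (-h) - u x‖ₑ)
          * (ENNReal.ofReal M * ENNReal.ofReal ‖h‖) := by
        refine lintegral_mono fun x => ?_
        rw [enorm_mul, ofReal_norm]
        refine mul_le_mul' ?_ ((ContinuousLinearMap.le_opENorm _ _).trans ?_)
        -- Passing through `u x` gives two first differences, hence the factor `min ‖h‖ 1`; the
        -- other factor `‖h‖` comes from `fderiv ℝ φ x h`.
        · rw [show extShift u τ x h - extShift u τ x (-h)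
            = (extShift u τ x h - u x) - (extShift u τ x (-h) - u x) by ring]
          exact enorm_sub_le
        · rw [← ofReal_norm (fderiv ℝ φ x)]
          gcongr
          exact hM x
    _ = ((∫⁻ x in box n R ε, ‖extShift u τ x h - u x‖ₑ)
          + ∫⁻ x in box n R ε, ‖extShift u τ x (-h) - u x‖ₑ)
          * (ENNReal.ofReal M * ENNReal.ofReal ‖h‖) := by
        rw [lintegral_mul_const' _ _ (by finiteness), lintegral_add_left hm]
    _ ≤ (C * ENNReal.ofReal (min ‖h‖ 1) + C * ENNReal.ofReal (min ‖-h‖ 1))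
          * (ENNReal.ofReal M * ENNReal.ofReal ‖h‖) := by
        gcongr
        · exact (hC h).1
        · exact (hC (-h)).1
    _ = _ := by
        rw [norm_neg, ENNReal.ofReal_mul (norm_nonneg h)]
        ring

/-- The integral is the convolution of `f` with the reflection of `φ`, evaluated at `t • h`;
differentiation falls on the smooth factor. -/
theorem hasDerivAt_integral_mul_translate {N : ℕ} {f φ : E N → ℝ} (hf : LocallyIntegrable f)
    (hφ : ContDiff ℝ ∞ φ) (hφc : HasCompactSupport φ) (h : E N) (t : ℝ) :
    HasDerivAt (fun t : ℝ => ∫ y, f y * φ (y - t • h))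
      (- ∫ y, f y * fderiv ℝ φ (y - t • h) h) t := by
  set g : E N → ℝ := fun z => φ (-z) with hg
  have hgd : ContDiff ℝ 1 g := (hφ.comp contDiff_neg).of_le (by simp)
  have hgc : HasCompactSupport g := hφc.comp_homeomorph (Homeomorph.neg (E N))
  have h1 := hgc.hasFDerivAt_convolution_right (ContinuousLinearMap.mul ℝ ℝ) hf hgd (t • h)
  have h2 : HasDerivAt (fun t : ℝ => t • h) h t := by
    simpa using (hasDerivAt_id t).smul_const h
  have h3 := h1.comp_hasDerivAt t h2
  have hgf : ∀ z v, fderiv ℝ g z v = - fderiv ℝ φ (-z) v := by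
    intro z v
    have hd := (hφ.differentiable (by simp) (-z)).hasFDerivAt.comp z (hasFDerivAt_id z).neg
    have he : fderiv ℝ g z = _ := hd.fderiv
    rw [he]
    simp
  rw [convolution_precompR_apply _ hf (hgc.fderiv ℝ) (hgd.continuous_fderiv one_ne_zero)] at h3
  refine (h3.congr_deriv ?_).congr_of_eventuallyEq (Eventually.of_forall fun t => ?_)
  rotate_left
  · simp only [Function.comp, convolution_def, hg, neg_sub, ContinuousLinearMap.mul_apply']
  · rw [convolution_def, ← integral_neg]
    refine integral_congr_ae (Eventually.of_forall fun y => ?_)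
    simp only [hgf, neg_sub, ContinuousLinearMap.mul_apply', mul_neg]

/-- By homogeneity the velocity `t • h` can be replaced by `h`. After translation, `t` appears only
in the argument of `F`. -/
theorem setIntegral_extShift_mul {u : E (n + 1) → ℝ} {τ : E n → ℝ} {B : Set (E (n + 1))}
    {F : E (n + 1) → ℝ} (hF : ∀ x, x ∉ B → F x = 0) (h : E (n + 1)) {t : ℝ} (ht : 0 < t) :
    ∫ x in B, extShift u τ x (t • h) * F x = ∫ y, extend u τ y h * F (y - t • h) := by
  rw [setIntegral_eq_integral_of_forall_compl_eq_zero fun x hx => by rw [hF x hx, mul_zero],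
    ← integral_add_right_eq_self (fun y => extend u τ y h * F (y - t • h)) (t • h)]
  refine integral_congr_ae (Eventually.of_forall fun x => ?_)
  simp only [extShift, extend_smul _ _ _ _ ht, add_sub_cancel_right]

theorem Admissible.hasDerivAt_setIntegral_extShift {u : E (n + 1) → ℝ} {τ : E n → ℝ}
    (H : Admissible u τ) {B : Set (E (n + 1))} {φ : E (n + 1) → ℝ}
    (hφ : ContDiff ℝ ∞ φ) (hφc : HasCompactSupport φ) (hB : tsupport φ ⊆ B)
    (h : E (n + 1)) {t : ℝ} (ht : 0 < t) :
    HasDerivAt (fun t : ℝ => ∫ x in B, extShift u τ x (t • h) * φ x)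
      (- ∫ x in B, extShift u τ x (t • h) * fderiv ℝ φ x h) t := by
  have z1 : ∀ x, x ∉ B → φ x = 0 := fun x hx =>
    image_eq_zero_of_notMem_tsupport fun hx' => hx (hB hx')
  have z2 : ∀ x, x ∉ B → fderiv ℝ φ x h = 0 := fun x hx => by
    rw [fderiv_of_notMem_tsupport ℝ fun hx' => hx (hB hx')]; rfl
  rw [setIntegral_extShift_mul z2 h ht]
  refine (hasDerivAt_integral_mul_translate (H.locallyIntegrable_extend h) hφ hφc h t).congr_of_eventuallyEq ?_
  filter_upwards [lt_mem_nhds ht] with r hr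
  exact setIntegral_extShift_mul z1 h hr

theorem Admissible.hasDerivAt_testedSecondDiff {u : E (n + 1) → ℝ} {τ : E n → ℝ}
    (H : Admissible u τ) {R ε : ℝ} (hε : 0 < ε) {φ : E (n + 1) → ℝ}
    (hφ : ContDiff ℝ ∞ φ) (hφc : HasCompactSupport φ) (hB : tsupport φ ⊆ box n R ε)
    (h : E (n + 1)) {t : ℝ} (ht : 0 < t) :
    HasDerivAt (fun t : ℝ => testedSecondDiff u τ (box n R ε) φ (t • h))
      (-(t⁻¹ * testedFirstDiff u τ (box n R ε) φ (t • h))) t := by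
  obtain ⟨M, hM⟩ := hφ.continuous.bounded_above_of_compact_support hφc
  obtain ⟨M', hM'⟩ := exists_norm_fderiv_le hφ hφc
  have i1 : ∀ h, Integrable (fun x => extShift u τ x h * φ x) (volume.restrict (box n R ε)) :=
    fun h => (H.integrableOn_extShift R ε h).mul_bdd hφ.continuous.aestronglyMeasurable
      (Eventually.of_forall hM)
  have i2 : Integrable (fun x => 2 * u x * φ x) (volume.restrict (box n R ε)) :=
    ((H.integrableOn_box_left R hε).const_mul 2).mul_bdd hφ.continuous.aestronglyMeasurable
      (Eventually.of_forall hM)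
  have i3 : ∀ h v, Integrable (fun x => extShift u τ x h * fderiv ℝ φ x v)
      (volume.restrict (box n R ε)) := fun h v =>
    (H.integrableOn_extShift R ε h).mul_bdd (c := M' * ‖v‖)
      ((hφ.continuous_fderiv (by simp)).clm_apply continuous_const).aestronglyMeasurable
      (Eventually.of_forall fun x => (ContinuousLinearMap.le_opNorm _ _).trans
        (mul_le_mul_of_nonneg_right (hM' _) (norm_nonneg _)))
  have d := ((H.hasDerivAt_setIntegral_extShift hφ hφc hB h ht).add
    (H.hasDerivAt_setIntegral_extShift hφ hφc hB (-h) ht)).sub_const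
      (∫ x in box n R ε, 2 * u x * φ x)
  refine (d.congr_deriv ?_).congr_of_eventuallyEq (Eventually.of_forall fun r => ?_)
  -- Linearity of `fderiv ℝ φ x` extracts the factor `t` and turns the contribution of `-h` into the
  -- minus sign of the first difference.
  · have e : testedFirstDiff u τ (box n R ε) φ (t • h)
        = t * ((∫ x in box n R ε, extShift u τ x (t • h) * fderiv ℝ φ x h)
          + ∫ x in box n R ε, extShift u τ x (t • -h) * fderiv ℝ φ x (-h)) := by
      rw [← integral_add (i3 _ _) (i3 _ _), ← integral_const_mul]
      refine integral_congr_ae (Eventually.of_forall fun x => ?_)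
      simp only [map_smul, map_neg, smul_neg, smul_eq_mul]
      ring
    rw [e, ← mul_assoc, inv_mul_cancel₀ ht.ne', one_mul]
    ring
  · have i4 : Integrable (fun x => extShift u τ x (r • h) * φ x + extShift u τ x (r • -h) * φ x)
      (volume.restrict (box n R ε)) := (i1 _).add (i1 _)
    simp only [Pi.add_apply]
    rw [← integral_add (i1 _) (i1 _), ← integral_sub i4 i2]
    refine integral_congr_ae (Eventually.of_forall fun x => ?_)
    simp only [smul_neg]
    ring

end Divergence

/-! ### Euler's relation and Fubini for the two pairings. -/

section DivergenceIdentity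

variable {n : ℕ}

theorem Admissible.stronglyMeasurable_testedSecondDiff {u : E (n + 1) → ℝ} {τ : E n → ℝ}
    (H : Admissible u τ) (B : Set (E (n + 1))) {φ : E (n + 1) → ℝ} (hφ : ContDiff ℝ ∞ φ) :
    StronglyMeasurable (testedSecondDiff u τ B φ) := by
  have hX := measurable_extShift H.measurable_left H.measurable_right
  have hm : Measurable fun q : E (n + 1) × E (n + 1) =>
      (extShift u τ q.2 q.1 + extShift u τ q.2 (-q.1) - 2 * u q.2) * φ q.2 :=
    (((hX.comp measurable_swap).add
      (hX.comp (f := fun q : E (n + 1) × E (n + 1) => (q.2, -q.1)) (by fun_prop))).sub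
        ((H.measurable_left.comp measurable_snd).const_mul 2)).mul
      (hφ.continuous.measurable.comp measurable_snd)
  exact hm.stronglyMeasurable.integral_prod_right

theorem Admissible.stronglyMeasurable_testedFirstDiff {u : E (n + 1) → ℝ} {τ : E n → ℝ}
    (H : Admissible u τ) (B : Set (E (n + 1))) {φ : E (n + 1) → ℝ} (hφ : ContDiff ℝ ∞ φ) :
    StronglyMeasurable (testedFirstDiff u τ B φ) := by
  have hX := measurable_extShift H.measurable_left H.measurable_right
  have hm : Measurable fun q : E (n + 1) × E (n + 1) =>
      (extShift u τ q.2 q.1 - extShift u τ q.2 (-q.1)) * fderiv ℝ φ q.2 q.1 :=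
    ((hX.comp measurable_swap).sub
      (hX.comp (f := fun q : E (n + 1) × E (n + 1) => (q.2, -q.1)) (by fun_prop))).mul
      (((hφ.continuous_fderiv (by simp)).comp continuous_snd).clm_apply continuous_fst).measurable
  exact hm.stronglyMeasurable.integral_prod_right

/-- The scaling `h ↦ t h` acts on the weighted integral by the factor `t ^ {2s}`. -/
theorem integral_comp_smul_mul_inv_norm_rpow (s : ℝ) (S : E (n + 1) → ℝ) {t : ℝ} (ht : 0 < t) :
    ∫ h, S (t • h) * (‖h‖ ^ (((n + 1 : ℕ) : ℝ) + 2 * s))⁻¹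
      = t ^ (2 * s) * ∫ h, S h * (‖h‖ ^ (((n + 1 : ℕ) : ℝ) + 2 * s))⁻¹ := by
  set p : ℝ := ((n + 1 : ℕ) : ℝ) + 2 * s with hp
  have h1 : ∀ h : E (n + 1), S (t • h) * (‖h‖ ^ p)⁻¹
      = t ^ p * (S (t • h) * (‖t • h‖ ^ p)⁻¹) := by
    intro h
    rw [norm_smul, Real.norm_of_nonneg ht.le, Real.mul_rpow ht.le (norm_nonneg h), mul_inv]
    have := (Real.rpow_pos_of_pos ht p).ne'
    field_simp
  simp only [h1]
  rw [integral_const_mul, Measure.integral_comp_smul volume (fun h => S h * (‖h‖ ^ p)⁻¹) t,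
    smul_eq_mul, ← mul_assoc, finrank_euclideanSpace, Fintype.card_fin,
    abs_of_pos (by positivity)]
  congr 1
  rw [← Real.rpow_natCast, ← Real.rpow_neg ht.le, ← Real.rpow_add ht, hp]
  congr 1
  ring

/-- Euler's relation: the weighted integrals of the tested second and first differences. -/
theorem Admissible.integral_testedSecondDiff {u : E (n + 1) → ℝ} {τ : E n → ℝ}
    (H : Admissible u τ) {s : ℝ} (hs : 1 / 2 < s) (hs' : s < 1) {R ε : ℝ} (hε : 0 < ε)
    {φ : E (n + 1) → ℝ} (hφ : ContDiff ℝ ∞ φ) (hφc : HasCompactSupport φ)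
    (hB : tsupport φ ⊆ box n R ε) :
    2 * s * ∫ h, testedSecondDiff u τ (box n R ε) φ h * (‖h‖ ^ (((n + 1 : ℕ) : ℝ) + 2 * s))⁻¹
      = - ∫ h, testedFirstDiff u τ (box n R ε) φ h
          * (‖h‖ ^ (((n + 1 : ℕ) : ℝ) + 2 * s))⁻¹ := by
  set p : ℝ := ((n + 1 : ℕ) : ℝ) + 2 * s with hp
  set S := testedSecondDiff u τ (box n R ε) φ with hS
  set T := testedFirstDiff u τ (box n R ε) φ with hT
  obtain ⟨C1, hC1⟩ := H.exists_norm_testedSecondDiff_le R hε hφ hφc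
  obtain ⟨C2, hC2⟩ := H.exists_norm_testedFirstDiff_le R hε hφ hφc
  have hSm : StronglyMeasurable S := H.stronglyMeasurable_testedSecondDiff _ hφ
  have hTm : StronglyMeasurable T := H.stronglyMeasurable_testedFirstDiff _ hφ
  have hκ : StronglyMeasurable fun h : E (n + 1) => (‖h‖ ^ p)⁻¹ :=
    Measurable.stronglyMeasurable (by fun_prop)
  have hk := integrable_kernel (n := n) hs hs'
  rw [← hp] at hk
  have hSi : Integrable fun h => S ((1 : ℝ) • h) * (‖h‖ ^ p)⁻¹ := by
    simp only [one_smul]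
    refine (hk.const_mul C1).mono' (hSm.mul hκ).aestronglyMeasurable
      (Eventually.of_forall fun h => ?_)
    rw [norm_mul, div_eq_mul_inv, ← mul_assoc, Real.norm_of_nonneg (by positivity : 0 ≤ (‖h‖ ^ p)⁻¹)]
    exact mul_le_mul_of_nonneg_right (hC1 h) (by positivity)
  -- At a unit vector the weight is `1`, so `C2` bounds a norm.
  have hC20 : 0 ≤ C2 := by
    by_contra hneg
    have h1 := hC2 (EuclideanSpace.single 0 1)
    simp only [PiLp.norm_single, norm_one, min_self, mul_one] at h1
    exact hneg ((norm_nonneg _).trans h1)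
  -- Differentiation under the integral at `t = 1`, to be compared with the derivative of `t ^ (2 *
  -- s)`. The factor `2` in the bound comes from `min (t‖h‖) 1 ≤ 2 min ‖h‖ 1` for `t < 2`.
  have hD := hasDerivAt_integral_of_dominated_loc_of_deriv_le (μ := (volume : Measure (E (n + 1))))
    (F := fun t h => S (t • h) * (‖h‖ ^ p)⁻¹)
    (F' := fun t h => -(t⁻¹ * T (t • h)) * (‖h‖ ^ p)⁻¹) (x₀ := (1 : ℝ)) (s := Ioo (1 / 2) 2)
    (bound := fun h => 2 * C2 * (‖h‖ * min ‖h‖ 1 / ‖h‖ ^ p))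
    (Ioo_mem_nhds (by norm_num) (by norm_num))
    (Eventually.of_forall fun t =>
      ((hSm.comp_measurable (measurable_const_smul t)).mul hκ).aestronglyMeasurable)
    hSi
    ((((hTm.comp_measurable (measurable_const_smul _)).const_mul _).neg).mul
      hκ).aestronglyMeasurable
    (Eventually.of_forall fun h t ht => ?_) (hk.const_mul _)
    (Eventually.of_forall fun h t ht => ?_)
  · have h1 : HasDerivAt (fun t : ℝ => t ^ (2 * s) * ∫ h, S h * (‖h‖ ^ p)⁻¹)
        (2 * s * ∫ h, S h * (‖h‖ ^ p)⁻¹) 1 := by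
      have := (Real.hasDerivAt_rpow_const (x := 1) (p := 2 * s) (Or.inl one_ne_zero)).mul_const
        (∫ h, S h * (‖h‖ ^ p)⁻¹)
      simpa using this
    have h2 := h1.congr_of_eventuallyEq (f₁ := fun t : ℝ => ∫ h, S (t • h) * (‖h‖ ^ p)⁻¹) (by
      filter_upwards [lt_mem_nhds (zero_lt_one' ℝ)] with t ht
      exact integral_comp_smul_mul_inv_norm_rpow s S ht)
    rw [h2.unique hD.2, ← integral_neg]
    refine integral_congr_ae (Eventually.of_forall fun h => ?_)
    simp
  · have ht0 : 0 < t := lt_trans (by norm_num) ht.1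
    have h1 := hC2 (t • h)
    rw [norm_smul, Real.norm_of_nonneg ht0.le] at h1
    have h2 : min (t * ‖h‖) 1 ≤ 2 * min ‖h‖ 1 := by
      rcases le_total ‖h‖ 1 with hh | hh
      · rw [min_eq_left hh]
        exact (min_le_left _ _).trans (mul_le_mul_of_nonneg_right ht.2.le (norm_nonneg _))
      · rw [min_eq_right hh]
        exact (min_le_right _ _).trans (by norm_num)
    rw [norm_mul, norm_neg, norm_mul, norm_inv, Real.norm_of_nonneg ht0.le,
      Real.norm_of_nonneg (by positivity : 0 ≤ (‖h‖ ^ p)⁻¹), div_eq_mul_inv, ← mul_assoc]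
    refine mul_le_mul_of_nonneg_right ?_ (by positivity)
    rw [inv_mul_le_iff₀ ht0]
    calc ‖T (t • h)‖ ≤ C2 * (t * ‖h‖ * min (t * ‖h‖) 1) := h1
      _ ≤ C2 * (t * ‖h‖ * (2 * min ‖h‖ 1)) := by gcongr
      _ = t * (2 * C2 * (‖h‖ * min ‖h‖ 1)) := by ring
  · have ht0 : 0 < t := lt_trans (by norm_num) ht.1
    exact (H.hasDerivAt_testedSecondDiff hε hφ hφc hB h ht0).mul_const _

theorem Admissible.setIntegral_symmDensity_mul {u : E (n + 1) → ℝ} {τ : E n → ℝ}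
    (H : Admissible u τ) {s : ℝ} (hs : 1 / 2 < s) (hs' : s < 1) (R : ℝ) {ε : ℝ} (hε : 0 < ε)
    {φ : E (n + 1) → ℝ} (hφ : ContDiff ℝ ∞ φ) (hφc : HasCompactSupport φ) :
    ∫ x in box n R ε, (∫ h, symmDensity s u τ x h) * φ x
      = ∫ h, testedSecondDiff u τ (box n R ε) φ h
          * (‖h‖ ^ (((n + 1 : ℕ) : ℝ) + 2 * s))⁻¹ := by
  obtain ⟨M, hM⟩ := hφ.continuous.bounded_above_of_compact_support hφc
  have hi : Integrable (fun q : E (n + 1) × E (n + 1) => symmDensity s u τ q.1 q.2 * φ q.1)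
      ((volume.restrict (box n R ε)).prod volume) :=
    (H.integrable_prod_second_difference hs hs' R hε).mul_bdd
      (hφ.continuous.comp continuous_fst).aestronglyMeasurable
      (Eventually.of_forall fun q => hM q.1)
  simp only [← integral_mul_const]
  rw [integral_integral_swap hi]
  refine integral_congr_ae (Eventually.of_forall fun h => ?_)
  simp only [testedSecondDiff, symmDensity]
  rw [← integral_mul_const]
  refine integral_congr_ae (Eventually.of_forall fun x => ?_)
  simp only
  ring

/-- After Fubini, averaging over `h` and `-h` cancels `u x`, because `fderiv ℝ φ x` is odd in `h`;
this produces the factor `1 / 2`. -/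
theorem Admissible.setIntegral_fderiv_gradDensity {u : E (n + 1) → ℝ} {τ : E n → ℝ}
    (H : Admissible u τ) {s : ℝ} (hs : 1 / 2 < s) (hs' : s < 1) (R : ℝ) {ε : ℝ} (hε : 0 < ε)
    {φ : E (n + 1) → ℝ} (hφ : ContDiff ℝ ∞ φ) (hφc : HasCompactSupport φ) :
    ∫ x in box n R ε, fderiv ℝ φ x (∫ h, gradDensity s u τ x h)
      = 1 / 2 * ∫ h, testedFirstDiff u τ (box n R ε) φ h
          * (‖h‖ ^ (((n + 1 : ℕ) : ℝ) + 2 * s))⁻¹ := by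
  obtain ⟨M, hM⟩ := exists_norm_fderiv_le hφ hφc
  have hD := H.integrable_gradDensity hs hs' R hε
  have hi : Integrable (fun q : E (n + 1) × E (n + 1) =>
      fderiv ℝ φ q.1 (gradDensity s u τ q.1 q.2))
      ((volume.restrict (box n R ε)).prod volume) := by
    refine (hD.norm.const_mul M).mono' ?_ (Eventually.of_forall fun q => ?_)
    · have hc : Continuous fun q : (E (n + 1) × E (n + 1)) => fderiv ℝ φ q.1 q.2 :=
        ((hφ.continuous_fderiv (by simp)).comp continuous_fst).clm_apply continuous_snd
      exact (hc.measurable.comp (measurable_fst.prodMk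
        (measurable_gradDensity s H.measurable_left H.measurable_right))).aestronglyMeasurable
    · exact (ContinuousLinearMap.le_opNorm _ _).trans
        (mul_le_mul_of_nonneg_right (hM _) (norm_nonneg _))
  set g : E (n + 1) → ℝ := fun h => ∫ x in box n R ε, fderiv ℝ φ x (gradDensity s u τ x h)
    with hg
  have hgi : Integrable g := hi.integral_prod_right
  have e1 : ∫ x in box n R ε, fderiv ℝ φ x (∫ h, gradDensity s u τ x h) = ∫ h, g h := by
    rw [hg, ← integral_integral_swap hi]
    refine integral_congr_ae (hD.prod_right_ae.mono fun x hx => ?_)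
    exact ((fderiv ℝ φ x).integral_comp_comm hx).symm
  have e2 : ∫ h, (g h + g (-h)) = 2 * ∫ h, g h := by
    rw [integral_add hgi hgi.comp_neg, integral_neg_eq_self g volume, two_mul]
  have i3 : ∀ h v, Integrable (fun x => (extShift u τ x h - u x) * fderiv ℝ φ x v)
      (volume.restrict (box n R ε)) := fun h v =>
    ((H.integrableOn_extShift R ε h).sub (H.integrableOn_box_left R hε)).mul_bdd (c := M * ‖v‖)
      ((hφ.continuous_fderiv (by simp)).clm_apply continuous_const).aestronglyMeasurable
      (Eventually.of_forall fun x => (ContinuousLinearMap.le_opNorm _ _).trans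
        (mul_le_mul_of_nonneg_right (hM _) (norm_nonneg _)))
  have hgv : ∀ h, g h = (∫ x in box n R ε, (extShift u τ x h - u x) * fderiv ℝ φ x h)
      * (‖h‖ ^ (((n + 1 : ℕ) : ℝ) + 2 * s))⁻¹ := by
    intro h
    rw [hg, ← integral_mul_const]
    refine integral_congr_ae (Eventually.of_forall fun x => ?_)
    simp only [gradDensity, map_smul, smul_eq_mul]
    ring
  have e3 : ∀ h, g h + g (-h) = testedFirstDiff u τ (box n R ε) φ h
      * (‖h‖ ^ (((n + 1 : ℕ) : ℝ) + 2 * s))⁻¹ := by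
    intro h
    rw [hgv, hgv, norm_neg, ← add_mul, ← integral_add (i3 _ _) (i3 _ _)]
    congr 1
    refine integral_congr_ae (Eventually.of_forall fun x => ?_)
    simp only [map_neg]
    ring
  simp only [e3] at e2
  rw [e1, e2]
  ring

end DivergenceIdentity

/-! ### Assembly: local integrability and the distributional divergence. -/

section Conclusion

variable {n : ℕ}

theorem fracGrad_eq {ψ u : E (n + 1) → ℝ} (γ ν₀ s : ℝ)
    (h : ψ =ᵐ[volume.restrict (Omega n : Set (E (n + 1)))] u) {x : E (n + 1)}
    (hx : ψ x = u x) :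
    fracGrad γ ν₀ s ψ x = (γ * ν₀ ^ (1 - 2 * s) * Real.Gamma (2 * s))
      • ∫ h, gradDensity s u (trace ψ) x h := by
  rw [fracGrad, integral_congr_ae (ae_gradKernel_eq s h hx)]
  exact congrArg _ (integral_sub_right_eq_self (gradDensity s u (trace ψ) x) x)

theorem locallyIntegrableOn_Omega_of_box {F : Type*} [NormedAddCommGroup F]
    {f : E (n + 1) → F} (hf : ∀ R ε : ℝ, 0 < ε → IntegrableOn f (box n R ε)) :
    LocallyIntegrableOn f (Omega n) volume := by
  rw [locallyIntegrableOn_iff (Omega n).isOpen.isLocallyClosed]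
  intro K hK hKc
  obtain ⟨R, ε, -, hε, hsub⟩ := exists_subset_box hKc hK
  exact (hf R ε hε).mono_set hsub

/-- Convergence of the integrals almost everywhere, with the values of the principal value and
of the nonlocal gradient as absolutely convergent integrals. -/
theorem ae_convergence {ψ u : E (n + 1) → ℝ} {s : ℝ} (hs : 1 / 2 < s) (hs' : s < 1)
    (h : ψ =ᵐ[volume.restrict (Omega n : Set (E (n + 1)))] u) (H : Admissible u (trace ψ))
    (γ ν₀ : ℝ) :
    ∀ᵐ x ∂(volume.restrict (Omega n : Set (E (n + 1)))),
      ((∀ δ : ℝ, 0 < δ → IntegrableOn (opKernel s ψ x) {y | δ < ‖y - x‖} volume) ∧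
        Tendsto (fun δ => truncOp γ ν₀ s ψ δ x) (𝓝[>] 0) (𝓝 (opL γ ν₀ s ψ x)) ∧
        Integrable (gradKernel s ψ x) volume) ∧
      opL γ ν₀ s ψ x = γ * ν₀ ^ (1 - 2 * s) * Real.Gamma (2 * s + 1)
        * (1 / 2 * ∫ h, symmDensity s u (trace ψ) x h) ∧
      fracGrad γ ν₀ s ψ x = (γ * ν₀ ^ (1 - 2 * s) * Real.Gamma (2 * s))
        • ∫ h, gradDensity s u (trace ψ) x h := by
  filter_upwards [h, H.ae_integrable_gradDensity hs hs', H.ae_integrable_symmDensity hs hs']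
    with x hx hg hq
  obtain ⟨h1, h2⟩ := integrable_and_tendsto_of_densities hs h hx H.measurable_left hg hq γ ν₀
  have hL : opL γ ν₀ s ψ x = _ := h2.limUnder_eq
  refine ⟨⟨h1, hL ▸ h2, ?_⟩, hL, fracGrad_eq γ ν₀ s h hx⟩
  exact (hg.comp_sub_right x).congr (ae_gradKernel_eq s h hx).symm

/-- The divergence identity. It holds for every `L²` boundary datum, so that only measurability and
square integrability of the trace enter. -/
theorem hasWeakDiv_fracGrad {ψ u : E (n + 1) → ℝ} {s : ℝ} (hs : 1 / 2 < s) (hs' : s < 1)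
    (h : ψ =ᵐ[volume.restrict (Omega n : Set (E (n + 1)))] u) (H : Admissible u (trace ψ))
    (γ ν₀ : ℝ) : HasWeakDiv (Omega n) (fracGrad γ ν₀ s ψ) (opL γ ν₀ s ψ) := by
  have hae := ae_convergence hs hs' h H γ ν₀
  have haeB : ∀ R ε : ℝ, 0 < ε → ∀ᵐ x ∂(volume.restrict (box n R ε)), _ := fun R ε hε =>
    ae_restrict_of_ae_restrict_of_subset (box_subset_Omega hε.le) hae
  refine ⟨locallyIntegrableOn_Omega_of_box fun R ε hε => ?_,
    locallyIntegrableOn_Omega_of_box fun R ε hε => ?_, fun φ => ?_⟩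
  · refine Integrable.congr ((H.integrable_gradDensity hs hs' R hε).integral_prod_left.smul
      (γ * ν₀ ^ (1 - 2 * s) * Real.Gamma (2 * s))) ?_
    exact (haeB R ε hε).mono fun x hx => hx.2.2.symm
  · refine Integrable.congr
      (((H.integrable_prod_second_difference hs hs' R hε).integral_prod_left.const_mul
        (1 / 2)).const_mul (γ * ν₀ ^ (1 - 2 * s) * Real.Gamma (2 * s + 1))) ?_
    exact (haeB R ε hε).mono fun x hx => hx.2.1.symm
  · have hφ : ContDiff ℝ ∞ φ := φ.contDiff
    have hφc : HasCompactSupport φ := φ.hasCompactSupport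
    obtain ⟨R, ε, -, hε, hB⟩ := exists_subset_box hφc.isCompact φ.tsupport_subset
    have z1 : ∀ x, x ∉ box n R ε → φ x = 0 := fun x hx =>
      image_eq_zero_of_notMem_tsupport fun hx' => hx (hB hx')
    have z2 : ∀ x, x ∉ box n R ε → fderiv ℝ φ x = 0 := fun x hx =>
      fderiv_of_notMem_tsupport ℝ fun hx' => hx (hB hx')
    have hBΩ : box n R ε ⊆ Omega n := box_subset_Omega hε.le
    rw [setIntegral_eq_of_subset_of_forall_sdiff_eq_zero (Omega n).isOpen.measurableSet hBΩ
        fun x hx => by rw [z2 x hx.2]; rfl,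
      setIntegral_eq_of_subset_of_forall_sdiff_eq_zero (Omega n).isOpen.measurableSet hBΩ
        fun x hx => by rw [z1 x hx.2, mul_zero]]
    have e1 : ∫ x in box n R ε, fderiv ℝ φ x (fracGrad γ ν₀ s ψ x)
        = (γ * ν₀ ^ (1 - 2 * s) * Real.Gamma (2 * s))
          * ∫ x in box n R ε, fderiv ℝ φ x (∫ h, gradDensity s u (trace ψ) x h) := by
      rw [← integral_const_mul]
      refine integral_congr_ae ((haeB R ε hε).mono fun x hx => ?_)
      simp only [hx.2.2, map_smul, smul_eq_mul]
    have e2 : ∫ x in box n R ε, opL γ ν₀ s ψ x * φ x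
        = (γ * ν₀ ^ (1 - 2 * s) * Real.Gamma (2 * s + 1)) * (1 / 2)
          * ∫ x in box n R ε, (∫ h, symmDensity s u (trace ψ) x h) * φ x := by
      rw [← integral_const_mul]
      refine integral_congr_ae ((haeB R ε hε).mono fun x hx => ?_)
      simp only [hx.2.1]
      ring
    have e3 := H.integral_testedSecondDiff hs hs' hε hφ hφc hB
    rw [e1, e2, H.setIntegral_symmDensity_mul hs hs' R hε hφ hφc,
      H.setIntegral_fderiv_gradDensity hs hs' R hε hφ hφc, Real.Gamma_add_one (by linarith)]
    -- The factor `2 * s` from Euler's relation is the quotient of the two Gamma factors.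
    linear_combination (γ * ν₀ ^ (1 - 2 * s) * Real.Gamma (2 * s)) / 2 * e3

end Conclusion

end

end HalfSpace

/-- In the upper half space `Ω` of dimension `N = n + 1` and for `ψ ∈ H²(Ω)`, the principal value
`𝓛[ψ](x)` and the absolutely convergent integral `D^{2s-1}[ψ](x)` exist for almost every `x ∈ Ω`,
and if `𝓛[ψ] ∈ L²(Ω)` then `𝓛[ψ] = div D^{2s-1}[ψ]` in `Ω`. -/
theorem mainTheorem12 (n : ℕ) (s γ ν₀ : ℝ) (hs : 1 / 2 < s) (hs' : s < 1)
    (hγ : 0 < γ) (hν₀ : 0 < ν₀)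
    (ψ : HalfSpace.E (n + 1) → ℝ) (hψ : HalfSpace.MemH2 (HalfSpace.Omega n) ψ) :
    (∀ᵐ x ∂(volume.restrict (HalfSpace.Omega n : Set (HalfSpace.E (n + 1)))),
      (∀ δ : ℝ, 0 < δ → IntegrableOn (HalfSpace.opKernel s ψ x) {y | δ < ‖y - x‖} volume) ∧
      Tendsto (fun δ => HalfSpace.truncOp γ ν₀ s ψ δ x) (𝓝[>] 0)
        (𝓝 (HalfSpace.opL γ ν₀ s ψ x)) ∧
      Integrable (HalfSpace.gradKernel s ψ x) volume) ∧
    (MemLp (HalfSpace.opL γ ν₀ s ψ) 2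
        (volume.restrict (HalfSpace.Omega n : Set (HalfSpace.E (n + 1)))) →
      HalfSpace.HasWeakDiv (HalfSpace.Omega n) (HalfSpace.fracGrad γ ν₀ s ψ)
        (HalfSpace.opL γ ν₀ s ψ)) := by
  -- `ψ` is only almost everywhere measurable on `Ω`; its measurable representative is paired with
  -- the trace of the original `ψ`.
  have hu := hψ.1.1.stronglyMeasurable_mk.measurable
  have h := hψ.1.1.ae_eq_mk
  have H : HalfSpace.Admissible (hψ.1.1.mk ψ) (HalfSpace.trace ψ) :=
    ⟨hu, HalfSpace.measurable_trace ψ, hψ.congr h, HalfSpace.memLp_trace ψ⟩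
  exact ⟨(HalfSpace.ae_convergence hs hs' h H γ ν₀).mono fun x hx => hx.1,
    fun _ => HalfSpace.hasWeakDiv_fracGrad hs hs' h H γ ν₀⟩
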